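/- \textbf{Model.} Users form a homogeneous Poisson point process (PPP) of density $\lambda>0$ in the plane, seen from a typical user at the origin (not itself counted, so self-service is ignored). There are $N_f$ files. The typical user requests file $i$ with the Zipf probability $p_r(i)=i^{-\beta}/\sum_{k=1}^{N_f}k^{-\beta}$, independently of everything else. The other users carry i.i.d. marks, independent of their locations: user $n$ caches one file, file $i$ with probability $p_c(i)$ ($p_c(i)\ge 0$, $\sum_i p_c(i)=1$); put $\lambda_i=\lambda p_c(i)$. Given that it caches file $i$, its coverage area has the Gamma-fitted Voronoi-cell density proportional to $\lambda_i^{3.5}x^{2.5}e^{-3.5\lambda_i x}$ conditioned to $[0,\pi r_c^2]$; given the area $x$, the number of receivers in it that request file $i$ is Poisson with mean $\lambda p_r(i)x$; the user is a D2D transmitter (DT) if this number is not zero. Its channel power gain $h_n$ to the origin is exponential with mean $1$ (Rayleigh fading), independent of its other marks. Let $r_n$ be the distance of user $n$ from the origin. If the typical user requests file $i$ and the nearest user caching file $i$, say user $n$, is at distance $r_n<r_c$, then user $n$ serves it. In the full reuse case the SINR is $$\gamma=\frac{P_t h_n r_n^{-\alpha}}{\sum_{m\ne n,\ m\text{ a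 DT}}P_t h_m r_m^{-\alpha}+\sigma^2},$$ and sending the file costs the energy $E_1=\dfrac{F}{W\log_2(1+\gamma)}\left(\dfrac{P_t}{\eta}+P_c\right)$. Here $\alpha>2$; $r_c,\sigma^2,P_t,\eta,F,W,\rho,Q,V_0>0$; $P_c\ge0$. The offloading probability $p_1(P_t,\rho)$ is the probability that there is such a serving user and that $E_1\le\rho QV_0$. \textbf{Statement.} Put $\sigma_0^2=\sigma^2/P_t$. Then $$p_1(P_t,\rho)=\sum_{i=1}^{N_f}p_r(i)\int_0^{r_c}f_i(r)\,e^{-\phi_i(\Gamma_1,r)}\,dr,$$ where $\Gamma_1=e^{\frac{F(P_t+\eta P_c)\ln 2}{W\rho QV_0\eta}}-1$, $f_i(r)=2\pi r\lambda_i e^{-\lambda_i\pi r^2}$, $$\phi_i(x,y)=xy^\alpha\sigma_0^2+\pi\bigl(\lambda_I\xi_1-\lambda_i^d\xi_2(x)\bigr)y^2x^{2/\alpha},$$ $\xi_1=\int_0^\infty\frac{dt}{1+t^{\alpha/2}}$, $\xi_2(x)=\int_0^{x^{-2/\alpha}}\frac{dt}{1+t^{\alpha/2}}$, $\lambda_I=\sum_{i=1}^{N_f}\lambda_i^d$,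 $$\lambda_i^d=\lambda_i\left(1-\left(1+\frac{\lambda p_r(i)}{3.5\lambda_i}\right)^{-3.5}\theta_i\right)\quad(\lambda_i^d=0\text{ if }\lambda_i=0),$$ $$\theta_i=\frac{\Gamma(3.5,0)-\Gamma\bigl(3.5,(3.5\lambda_i+\lambda p_r(i))\pi r_c^2\bigr)}{\Gamma(3.5,0)-\Gamma(3.5,3.5\lambda_i\pi r_c^2)},\qquad \Gamma(s,x)=\int_x^\infty t^{s-1}e^{-t}\,dt.$$ Moreover, for every $i$, $f_i$ is the density of the distance from the origin to the nearest user caching file $i$ (that is, this distance is at most $r$ with probability $\int_0^r f_i(s)\,ds$ for all $r\ge 0$; if $\lambda_i=0$ there is no such user); $\lambda_i^d$ is the density of the DTs caching file $i$, and $\lambda_I$ is the density of all DTs (the expected number of such points in a Borel set of area $a$ is $\lambda_i^d a$, respectively $\lambda_I a$). -/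

import Mathlib

open MeasureTheory ProbabilityTheory
open scoped ENNReal

noncomputable section

namespace D2D

/-- The plane, with Euclidean distance and Lebesgue measure. -/
abbrev Plane : Type := EuclideanSpace ℝ (Fin 2)

/-- The (possibly infinite) number of points of the family `X` lying in `B`. -/
def count {Ω E : Type*} (X : ℕ → Ω → E) (B : Set E) (ω : Ω) : ℕ∞ :=
  {n : ℕ | X n ω ∈ B}.encard

/-- The points `X 0, X 1, …` form a Poisson point process with intensity measure `μ`:
the number of points in a set of finite intensity is Poisson distributed, and the numbers of
points in pairwise disjoint sets are independent. -/
structure IsPoissonPointProcess {Ω E : Type*} [MeasurableSpace Ω] [MeasurableSpace E]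
    (P : Measure Ω) (X : ℕ → Ω → E) (μ : Measure E) : Prop where
  measurable : ∀ n, Measurable (X n)
  count_law : ∀ B : Set E, MeasurableSet B → μ B < ∞ → ∀ k : ℕ,
    P {ω | count X B ω = k} = poissonMeasure (μ B).toNNReal {k}
  indep : ∀ (m : ℕ) (B : Fin m → Set E), (∀ j, MeasurableSet (B j)) →
    Pairwise (Function.onFun Disjoint B) → iIndepFun (fun j => count X (B j)) P

/-- The parameters of the network, with a catalog of `N` files; file `i + 1` of the catalog is
represented by `i : Fin N`. -/
structure Params (N : ℕ) where
  /-- user density -/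
  lam : ℝ
  /-- collaboration distance -/
  rc : ℝ
  /-- Zipf parameter -/
  beta : ℝ
  /-- caching distribution -/
  pc : Fin N → ℝ
  /-- path loss exponent -/
  alpha : ℝ
  /-- noise variance -/
  sigmaSq : ℝ
  /-- transmit power -/
  Pt : ℝ
  /-- circuit power -/
  Pc : ℝ
  /-- power amplifier efficiency -/
  eta : ℝ
  /-- file size -/
  F : ℝ
  /-- bandwidth -/
  W : ℝ
  /-- allowed fraction of the battery capacity -/
  rho : ℝ
  /-- battery capacity -/
  Q : ℝ
  /-- operating voltage -/
  V0 : ℝ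

namespace Params

variable {N : ℕ} (p : Params N)

/-- The ranges of the parameters. -/
structure Admissible : Prop where
  lam_pos : 0 < p.lam
  rc_pos : 0 < p.rc
  pc_nonneg : ∀ i, 0 ≤ p.pc i
  pc_sum : ∑ i, p.pc i = 1
  two_lt_alpha : 2 < p.alpha
  sigmaSq_pos : 0 < p.sigmaSq
  Pt_pos : 0 < p.Pt
  Pc_nonneg : 0 ≤ p.Pc
  eta_pos : 0 < p.eta
  F_pos : 0 < p.F
  W_pos : 0 < p.W
  rho_pos : 0 < p.rho
  Q_pos : 0 < p.Q
  V0_pos : 0 < p.V0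

/-- Zipf popularity of a file. -/
def popularity (i : Fin N) : ℝ :=
  ((i : ℝ) + 1) ^ (-p.beta) / ∑ k : Fin N, ((k : ℝ) + 1) ^ (-p.beta)

/-- Density of the users that cache the file `i`. -/
def helperDensity (i : Fin N) : ℝ := p.lam * p.pc i

/-- Law of the coverage area of a helper that caches file `i`: the Gamma law with density
`3.5 ^ 3.5 / Γ(3.5) * λᵢ ^ 3.5 * x ^ 2.5 * exp (-3.5 * λᵢ * x)`, which is fitted to the area of the
typical Poisson–Voronoi cell, conditioned on the area being at most `π * rc ^ 2`. -/
def coverageLaw (i : Fin N) : Measure ℝ :=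
  (gammaMeasure 3.5 (3.5 * p.helperDensity i))[|Set.Icc 0 (Real.pi * p.rc ^ 2)]

end Params

/-- The random objects of the network, as seen from a typical user at the origin. -/
structure Network (N : ℕ) (Ω : Type*) where
  /-- location of the `n`-th other user -/
  pos : ℕ → Ω → Plane
  /-- file cached at user `n` -/
  cached : ℕ → Ω → Fin N
  /-- coverage area of user `n` as a helper -/
  area : ℕ → Ω → ℝ
  /-- number of receivers in this area that request the file cached at user `n` -/
  demand : ℕ → Ω → ℕ
  /-- channel power gain from user `n` to the typical user -/
  gain : ℕ → Ω → ℝ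
  /-- file requested by the typical user -/
  request : Ω → Fin N

namespace Network

variable {N : ℕ} {Ω : Type*} (net : Network N Ω)

/-- All marks of user `n`. -/
def mark (n : ℕ) (ω : Ω) : (Fin N × ℝ × ℕ) × ℝ :=
  ((net.cached n ω, net.area n ω, net.demand n ω), net.gain n ω)

/-- The probabilistic model. The users form a homogeneous Poisson process of density `λ` and carry
i.i.d. marks, independent of the locations: the cached file has law `p.pc`, the coverage area of a
user caching file `i` has law `p.coverageLaw i`, given the area `x` the number of receivers in it
that request file `i` is Poisson with mean `λ * p_r(i) * x`, and the channel gain (Rayleigh fading)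
is exponential with unit mean. The request of the typical user is Zipf distributed and independent
of everything else. -/
structure Model [MeasurableSpace Ω] (P : Measure Ω) (p : Params N) : Prop where
  users : IsPoissonPointProcess P net.pos (ENNReal.ofReal p.lam • (volume : Measure Plane))
  measurable_mark : ∀ n, Measurable (net.mark n)
  helper_law : ∀ (n : ℕ) (i : Fin N) (B : Set ℝ) (k : ℕ), MeasurableSet B →
    P {ω | net.cached n ω = i ∧ net.area n ω ∈ B ∧ net.demand n ω = k} =
      ENNReal.ofReal (p.pc i) *
        ∫⁻ x in B, poissonMeasure (p.lam * p.popularity i * x).toNNReal {k} ∂(p.coverageLaw i)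
  gain_law : ∀ n, P.map (net.gain n) = expMeasure 1
  gain_indep : ∀ n, IndepFun (fun ω => (net.cached n ω, net.area n ω, net.demand n ω))
    (net.gain n) P
  marks_indep : iIndepFun net.mark P
  pos_marks_indep : IndepFun (fun ω n => net.pos n ω) (fun ω n => net.mark n ω) P
  measurable_request : Measurable net.request
  request_law : ∀ i, P {ω | net.request ω = i} = ENNReal.ofReal (p.popularity i)
  request_indep : IndepFun net.request
    (fun ω => ((fun n => net.pos n ω), (fun n => net.mark n ω))) P

/-- User `n` is a D2D transmitter: a file request falls in its coverage. -/
def IsTransmitter (n : ℕ) (ω : Ω) : Prop := net.demand n ω ≠ 0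

/-- Power received at the typical user from user `n`. -/
def received (p : Params N) (n : ℕ) (ω : Ω) : ℝ≥0∞ :=
  ENNReal.ofReal (p.Pt * net.gain n ω) * ‖net.pos n ω‖ₑ ^ (-p.alpha)

open Classical in
/-- Total interference (full reuse) at the typical user when it is served by user `n`. -/
def interference (p : Params N) (n : ℕ) (ω : Ω) : ℝ≥0∞ :=
  ∑' m : ℕ, if m ≠ n ∧ net.IsTransmitter m ω then net.received p m ω else 0

/-- Signal to interference plus noise ratio at the typical user when it is served by user `n`. -/
def sinr (p : Params N) (n : ℕ) (ω : Ω) : ℝ≥0∞ :=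
  net.received p n ω / (net.interference p n ω + ENNReal.ofReal p.sigmaSq)

/-- Data rate from user `n` to the typical user. -/
def rate (p : Params N) (n : ℕ) (ω : Ω) : ℝ :=
  p.W * Real.logb 2 (1 + (net.sinr p n ω).toReal)

/-- Energy spent by user `n` to transmit a whole file to the typical user
(infinite if the rate is zero). -/
def energy (p : Params N) (n : ℕ) (ω : Ω) : ℝ≥0∞ :=
  ENNReal.ofReal p.F / ENNReal.ofReal (net.rate p n ω) *
    ENNReal.ofReal (1 / p.eta * p.Pt + p.Pc)

/-- User `n` is a nearest one among the users that cache the file `i`. -/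
def IsNearestHelper (i : Fin N) (n : ℕ) (ω : Ω) : Prop :=
  net.cached n ω = i ∧ ∀ m, net.cached m ω = i → ‖net.pos n ω‖ ≤ ‖net.pos m ω‖

/-- Distance from the typical user to the nearest user that caches the file `i`. -/
def helperDist (i : Fin N) (ω : Ω) : ℝ≥0∞ :=
  ⨅ (n : ℕ) (_ : net.cached n ω = i), ‖net.pos n ω‖ₑ

/-- The offloading probability: the typical user finds its requested file at a user within the
collaboration distance, and the nearest such user can transmit the complete file within the
allowed battery consumption. -/
def offloadingProbability [MeasurableSpace Ω] (P : Measure Ω) (p : Params N) : ℝ :=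
  P.real {ω | ∃ n, net.IsNearestHelper (net.request ω) n ω ∧ ‖net.pos n ω‖ < p.rc ∧
    net.energy p n ω ≤ ENNReal.ofReal (p.rho * p.Q * p.V0)}

end Network

/-- Upper incomplete Gamma function. -/
def upperGamma (s x : ℝ) : ℝ := ∫ t in Set.Ioi x, t ^ (s - 1) * Real.exp (-t)

namespace Params

variable {N : ℕ} (p : Params N)

/-- The SINR threshold `Γ₁`. -/
def Gamma1 : ℝ :=
  Real.exp (p.F * (p.Pt + p.eta * p.Pc) * Real.log 2 / (p.W * p.rho * p.Q * p.V0 * p.eta)) - 1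

/-- The density `fᵢ` of the link distance. -/
def linkPdf (i : Fin N) (r : ℝ) : ℝ :=
  2 * Real.pi * r * p.helperDensity i * Real.exp (-(p.helperDensity i * Real.pi * r ^ 2))

/-- `θᵢ` -/
def theta (i : Fin N) : ℝ :=
  (upperGamma 3.5 0 -
      upperGamma 3.5 ((3.5 * p.helperDensity i + p.lam * p.popularity i) * (Real.pi * p.rc ^ 2))) /
    (upperGamma 3.5 0 - upperGamma 3.5 (3.5 * p.helperDensity i * (Real.pi * p.rc ^ 2)))

/-- The closed form `λᵢᵈ`. It is zero if `helperDensity i = 0`, whatever the second factor. -/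
def txDensity (i : Fin N) : ℝ :=
  p.helperDensity i *
    (1 - (1 + p.lam * p.popularity i / (3.5 * p.helperDensity i)) ^ (-3.5 : ℝ) * p.theta i)

/-- `λ_I` -/
def totalTxDensity : ℝ := ∑ i, p.txDensity i

/-- `ξ₁` -/
def xi1 : ℝ := ∫ t in Set.Ioi (0 : ℝ), 1 / (1 + t ^ (p.alpha / 2))

/-- `ξ₂`, as a function of `x` -/
def xi2 (x : ℝ) : ℝ := ∫ t in (0 : ℝ)..x ^ (-2 / p.alpha), 1 / (1 + t ^ (p.alpha / 2))

/-- `φᵢ(x, y)`, with `σ₀² = σ² / Pt` -/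
def phi (i : Fin N) (x y : ℝ) : ℝ :=
  x * y ^ p.alpha * (p.sigmaSq / p.Pt) +
    Real.pi * (p.totalTxDensity * p.xi1 - p.txDensity i * p.xi2 x) * y ^ 2 * x ^ (2 / p.alpha)

end Params

end D2D

end

/-!
The proof conditions on the locations of the users and integrates out their marks.

The energy constraint on the serving user `n` is `Γ₁ ≤ γ`, that is, the gain of user `n` is at
least `Γ₁ r ^ α σ₀²` plus the interference with normalized weights `Γ₁ (r / r_m) ^ α`
(`Network.energy_le_iff_gain`). The gain is exponential and independent of everything else, so,
conditionally on the locations, the probability that user `n` caches file `i`, that no nearer user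
does, and that the constraint holds is `p_c(i) exp (-Γ₁ r ^ α σ₀²)` times an infinite product over
the other users (`measure_served`). The factor of a user at `y` is `1 - U(r, y)`, where the "defect"
`U(r, y)` (`pointDefect`) accounts both for the event that the user is a nearer helper and for the
Laplace transform of its interference.

As two users are almost surely not at the same distance (`ae_norm_injective`), the events that user
`n` is the serving one are disjoint up to null sets, and their probabilities can be added. The sum
over `n` of the mean of a weight at the point `n` times a product over the other points is given by
the Mecke formula
`∑ₙ 𝔼 [w(Xₙ) ∏_{m ≠ n} (1 - u(R(Xₙ), X_m))] = ∫ w(x) exp (-∫ u(R(x), y) dμ(y)) dμ(x)`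
(`mecke_monotone`). For functions that are constant on the cells of a finite partition it is a
computation with independent Poisson counts (`mecke_partition`), and monotone limits give the
general case. Here `R(x) = ‖x‖`, and `U(r, y)` increases with `r` because a transmitter that
caches file `i` is in particular a user that caches file `i`.

The remaining integrals are radial. In the variable `t = ‖y‖²` the integral of the defect gives
`ξ₁`, `ξ₂` and the exponent `λᵢ π r²` of `fᵢ` (`integral_pointDefect`), and the integral over the
position of the serving user becomes the integral over `r`. The closed form of `λᵢᵈ` comes from the
Laplace transform of a truncated Gamma law: a user that caches file `i` is not a transmitter with
probability `𝔼 exp (-λ p_r(i) x)`, where `x` is its coverage area (`lintegral_no_demand`).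
The density of the nearest-helper distance is obtained from the probability that a thinned Poisson
process has no points in a disk (`measure_no_helper`), and the transmitter densities from Campbell's
formula (`lintegral_encard`).
-/

namespace D2D

open Filter Topology Finset

/-! ### Exponentials and infinite products in `[0, ∞]` -/

/-- The function `a ↦ exp (-a)` on `[0, ∞]`, with `exp (-∞) = 0`. -/
noncomputable def expNeg (a : ℝ≥0∞) : ℝ≥0∞ := EReal.exp (-(a : EReal))

/-- The infinite product `∏ m, a m` of factors in `[0, 1]`, as the infimum of the partial
products. -/
noncomputable def iprod (a : ℕ → ℝ≥0∞) : ℝ≥0∞ := ⨅ K, ∏ m ∈ range K, a m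

@[simp] lemma expNeg_zero : expNeg 0 = 1 := by simp [expNeg]

@[simp] lemma expNeg_top : expNeg ∞ = 0 := by simp [expNeg]

lemma expNeg_ofReal {x : ℝ} (hx : 0 ≤ x) :
    expNeg (ENNReal.ofReal x) = ENNReal.ofReal (Real.exp (-x)) := by
  rw [expNeg, EReal.coe_ennreal_ofReal, max_eq_left hx, ← EReal.coe_neg, EReal.exp_coe]

lemma expNeg_add (a b : ℝ≥0∞) : expNeg (a + b) = expNeg a * expNeg b := by
  rw [expNeg, expNeg, expNeg, ← EReal.exp_add, EReal.coe_ennreal_add, EReal.neg_add,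
    sub_eq_add_neg]
  · exact Or.inl (by simp)
  · exact Or.inr (by simp)

lemma antitone_expNeg : Antitone expNeg := fun a b h => by
  simpa [expNeg] using h

lemma expNeg_le_one (a : ℝ≥0∞) : expNeg a ≤ 1 :=
  (antitone_expNeg (zero_le : 0 ≤ a)).trans_eq expNeg_zero

lemma expNeg_ne_top (a : ℝ≥0∞) : expNeg a ≠ ∞ :=
  ((expNeg_le_one a).trans_lt ENNReal.one_lt_top).ne

lemma continuous_expNeg : Continuous expNeg :=
  EReal.expHomeomorph.continuous.comp (continuous_neg.comp continuous_coe_ennreal_ereal)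

@[fun_prop] lemma measurable_expNeg : Measurable expNeg := continuous_expNeg.measurable

lemma expNeg_iSup {ι : Sort*} (f : ι → ℝ≥0∞) (h : Nonempty ι) :
    expNeg (⨆ i, f i) = ⨅ i, expNeg (f i) :=
  antitone_expNeg.map_ciSup_of_continuousAt continuous_expNeg.continuousAt

lemma expNeg_sum {ι : Type*} (s : Finset ι) (f : ι → ℝ≥0∞) :
    expNeg (∑ i ∈ s, f i) = ∏ i ∈ s, expNeg (f i) := by
  classical
  induction s using Finset.induction_on with
  | empty => simp
  | insert a s ha ih => rw [sum_insert ha, prod_insert ha, expNeg_add, ih]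

lemma antitone_partialProd {a : ℕ → ℝ≥0∞} (ha : ∀ m, a m ≤ 1) :
    Antitone fun K => ∏ m ∈ range K, a m := by
  refine antitone_nat_of_succ_le fun K => ?_
  rw [prod_range_succ]
  exact mul_le_of_le_one_right' (ha K)

lemma tendsto_partialProd {a : ℕ → ℝ≥0∞} (ha : ∀ m, a m ≤ 1) :
    Tendsto (fun K => ∏ m ∈ range K, a m) atTop (𝓝 (iprod a)) :=
  tendsto_atTop_iInf (antitone_partialProd ha)

lemma iprod_le_one (a : ℕ → ℝ≥0∞) : iprod a ≤ 1 :=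
  (iInf_le _ 0).trans_eq (by simp)

lemma iprod_ne_top (a : ℕ → ℝ≥0∞) : iprod a ≠ ∞ :=
  ((iprod_le_one a).trans_lt ENNReal.one_lt_top).ne

lemma iprod_mono {a b : ℕ → ℝ≥0∞} (h : ∀ m, a m ≤ b m) : iprod a ≤ iprod b :=
  iInf_mono fun _ => prod_le_prod' fun m _ => h m

@[simp] lemma iprod_one : iprod (fun _ => 1) = 1 := by simp [iprod]

lemma iprod_mul {a b : ℕ → ℝ≥0∞} (ha : ∀ m, a m ≤ 1) (hb : ∀ m, b m ≤ 1) :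
    iprod (fun m => a m * b m) = iprod a * iprod b := by
  refine tendsto_nhds_unique (tendsto_partialProd fun m => mul_le_one' (ha m) (hb m)) ?_
  simp_rw [prod_mul_distrib]
  exact ENNReal.Tendsto.mul (tendsto_partialProd ha) (Or.inr (iprod_ne_top _))
    (tendsto_partialProd hb) (Or.inr (iprod_ne_top _))

lemma iprod_finsetProd {ι : Type*} (s : Finset ι) {a : ι → ℕ → ℝ≥0∞} (ha : ∀ i m, a i m ≤ 1) :
    iprod (fun m => ∏ i ∈ s, a i m) = ∏ i ∈ s, iprod (a i) := by
  classical
  induction s using Finset.induction_on with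
  | empty => simp
  | insert i s hi ih =>
    simp_rw [prod_insert hi]
    rw [iprod_mul (ha i) (fun m => prod_le_one' fun j _ => ha j m), ih]

lemma iprod_eq_of_finite {S : Set ℕ} (hS : S.Finite) {a : ℕ → ℝ≥0∞} (ha : ∀ m, a m ≤ 1)
    (h1 : ∀ m ∉ S, a m = 1) : iprod a = ∏ m ∈ hS.toFinset, a m := by
  refine tendsto_nhds_unique (tendsto_partialProd ha) (tendsto_const_nhds.congr' ?_)
  obtain ⟨K, hK⟩ := hS.bddAbove
  filter_upwards [eventually_gt_atTop K] with L hL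
  refine prod_subset (fun m hm => ?_) (fun m _ hm => h1 m (by simpa using hm))
  have := hK ((Set.Finite.mem_toFinset hS).1 hm)
  exact mem_range.2 (by omega)

lemma iprod_ite_const {S : Set ℕ} [DecidablePred (· ∈ S)] (hS : S.Finite) {c : ℝ≥0∞} (hc : c ≤ 1) :
    iprod (fun m => if m ∈ S then c else 1) = c ^ S.ncard := by
  rw [iprod_eq_of_finite hS (fun m => by split_ifs <;> simp [hc]) (fun m hm => by simp [hm]),
    prod_congr rfl (g := fun _ => c) (fun m hm => if_pos (by simpa using hm)), prod_const,
    Set.ncard_eq_toFinset_card S hS]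

lemma iprod_expNeg (a : ℕ → ℝ≥0∞) : iprod (fun m => expNeg (a m)) = expNeg (∑' m, a m) := by
  refine tendsto_nhds_unique (tendsto_partialProd fun m => expNeg_le_one _) ?_
  simp_rw [← expNeg_sum]
  exact (continuous_expNeg.tendsto _).comp ENNReal.summable.hasSum.tendsto_sum_nat

lemma iprod_indicator (p : ℕ → Prop) [DecidablePred p] [Decidable (∀ m, p m)] :
    iprod (fun m => if p m then 1 else 0) = if ∀ m, p m then 1 else 0 := by
  split_ifs with h
  · simp [h]
  · push Not at h
    obtain ⟨m, hm⟩ := h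
    refine le_antisymm ((iInf_le _ (m + 1)).trans_eq ?_) zero_le
    exact prod_eq_zero (self_mem_range_succ m) (if_neg hm)

lemma iprod_iInf {a : ℕ → ℕ → ℝ≥0∞} (ha : ∀ k m, a k m ≤ 1) (h : ∀ m, Antitone fun k => a k m) :
    iprod (fun m => ⨅ k, a k m) = ⨅ k, iprod (a k) := by
  unfold iprod
  rw [iInf_comm]
  refine iInf_congr fun K => ?_
  refine tendsto_nhds_unique (ENNReal.tendsto_finsetProd_of_ne_top (f := fun m k => a k m) (range K)
    (fun m _ => tendsto_atTop_iInf (h m)) (fun m _ => ?_)) (tendsto_atTop_iInf ?_)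
  · exact (((iInf_le _ 0).trans (ha 0 m)).trans_lt ENNReal.one_lt_top).ne
  · exact fun k l hkl => prod_le_prod' fun m _ => h m hkl

@[fun_prop] lemma measurable_iprod {α : Type*} [MeasurableSpace α] {a : ℕ → α → ℝ≥0∞}
    (ha : ∀ m, Measurable (a m)) : Measurable fun x => iprod fun m => a m x :=
  Measurable.iInf fun _ => Finset.measurable_fun_prod _ fun m _ => ha m

lemma lintegral_iprod_of_iIndepFun {Ω : Type*} [MeasurableSpace Ω] {P : Measure Ω}
    [IsProbabilityMeasure P] {a : ℕ → Ω → ℝ≥0∞} (hm : ∀ m, Measurable (a m))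
    (h1 : ∀ m ω, a m ω ≤ 1) (hi : iIndepFun a P) :
    ∫⁻ ω, iprod (fun m => a m ω) ∂P = iprod fun m => ∫⁻ ω, a m ω ∂P := by
  unfold iprod
  rw [lintegral_iInf (fun K => Finset.measurable_fun_prod _ fun m _ => hm m)]
  · refine iInf_congr fun K => ?_
    have := lintegral_prod_eq_prod_lintegral_of_indepFun (μ := P) (range K) a hi hm
    simpa using this
  · exact fun K L hKL ω => antitone_partialProd (fun m => h1 m ω) hKL
  · simp

/-! ### Poisson point processes -/

lemma lintegral_poissonMeasure (r : NNReal) (f : ℕ → ℝ≥0∞) :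
    ∫⁻ k, f k ∂(poissonMeasure r) =
      ∑' k, f k * ENNReal.ofReal (Real.exp (-r) * r ^ k / k.factorial) := by
  rw [lintegral_countable']
  simp_rw [poissonMeasure_singleton]

lemma lintegral_pow_poissonMeasure (r : NNReal) {u : ℝ≥0∞} (hu : u ≤ 1) :
    ∫⁻ k, (1 - u) ^ k ∂(poissonMeasure r) = expNeg (u * r) := by
  lift u to NNReal using (hu.trans_lt ENNReal.one_lt_top).ne
  have hu' : (u : ℝ) ≤ 1 := by exact_mod_cast hu
  have h1 : (1 - (u : ℝ≥0∞)) = ENNReal.ofReal (1 - u) := by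
    rw [ENNReal.ofReal_sub _ u.coe_nonneg]; simp
  have h2 : (u * r : ℝ≥0∞) = ENNReal.ofReal (u * r) := by
    rw [ENNReal.ofReal_mul u.coe_nonneg]; simp
  have h0 : (0 : ℝ) ≤ 1 - u := by linarith
  have hs := (NormedSpace.expSeries_div_hasSum_exp (((1 - u) * r : ℝ))).mul_left (Real.exp (-r))
  rw [lintegral_poissonMeasure, h2, expNeg_ofReal (by positivity), h1]
  rw [← congr_fun Real.exp_eq_exp_ℝ, ← Real.exp_add] at hs
  rw [show (-((u : ℝ) * r)) = -r + (1 - u) * r by ring, ← hs.tsum_eq,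
    ENNReal.ofReal_tsum_of_nonneg (fun k => by positivity) hs.summable]
  refine tsum_congr fun k => ?_
  rw [← ENNReal.ofReal_pow h0, ← ENNReal.ofReal_mul (by positivity)]
  congr 1
  rw [mul_pow]; ring

/-- The size-biased form of `lintegral_pow_poissonMeasure`; it accounts for the cell that contains
the distinguished point in the Mecke formula. -/
lemma lintegral_mul_pow_poissonMeasure (r : NNReal) {u : ℝ≥0∞} (hu : u ≤ 1) :
    ∫⁻ k, k * (1 - u) ^ (k - 1) ∂(poissonMeasure r) = r * expNeg (u * r) := by
  rw [← lintegral_pow_poissonMeasure r hu, lintegral_poissonMeasure, lintegral_poissonMeasure,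
    tsum_eq_zero_add' ENNReal.summable]
  simp only [Nat.cast_zero, zero_mul, zero_add, Nat.add_sub_cancel]
  rw [← ENNReal.tsum_mul_left]
  refine tsum_congr fun k => ?_
  have : ENNReal.ofReal (Real.exp (-r) * r ^ (k + 1) / (k + 1).factorial) * ((k + 1 : ℕ) : ℝ≥0∞)
      = r * ENNReal.ofReal (Real.exp (-r) * r ^ k / k.factorial) := by
    rw [← ENNReal.ofReal_natCast, ← ENNReal.ofReal_mul (by positivity), ← ENNReal.ofReal_coe_nnreal,
      ← ENNReal.ofReal_mul (by positivity)]
    congr 1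
    rw [Nat.factorial_succ]
    push_cast
    have : (k.factorial : ℝ) ≠ 0 := by positivity
    field_simp
    ring
  calc _ = (1 - u) ^ k * (ENNReal.ofReal (Real.exp (-r) * r ^ (k + 1) / (k + 1).factorial)
        * ((k + 1 : ℕ) : ℝ≥0∞)) := by ring
    _ = _ := by rw [this]; ring

section Count

variable {Ω E : Type*} [MeasurableSpace Ω] [MeasurableSpace E] {P : Measure Ω}
  {X : ℕ → Ω → E} {μ : Measure E}

lemma toENNReal_count {Ω E : Type*} (X : ℕ → Ω → E) (B : Set E) (ω : Ω) :
    (count X B ω : ℝ≥0∞) = ∑' n, B.indicator 1 (X n ω) := by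
  rw [count, ← ENNReal.tsum_set_one]
  exact _root_.tsum_subtype _ (fun _ => (1 : ℝ≥0∞))

lemma measurable_count (hX : ∀ n, Measurable (X n)) {B : Set E} (hB : MeasurableSet B) :
    Measurable (count X B) := by
  refine measurable_to_countable fun ω₀ => ?_
  have hm : Measurable fun ω => (count X B ω : ℝ≥0∞) := by
    simp_rw [toENNReal_count]
    exact Measurable.tsum fun n => (measurable_one.indicator hB).comp (hX n)
  convert hm (measurableSet_singleton (count X B ω₀ : ℝ≥0∞)) using 1
  ext ω
  simp

namespace IsPoissonPointProcess

variable [IsProbabilityMeasure P] (hX : IsPoissonPointProcess P X μ)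
include hX

lemma map_count {B : Set E} (hB : MeasurableSet B) (hfin : μ B ≠ ∞) :
    P.map (count X B) = (poissonMeasure (μ B).toNNReal).map (fun k : ℕ => (k : ℕ∞)) := by
  have hc := measurable_count hX.measurable hB
  have h0 (k : ℕ) : P.map (count X B) {(k : ℕ∞)} =
      (poissonMeasure (μ B).toNNReal).map (fun k : ℕ => (k : ℕ∞)) {(k : ℕ∞)} := by
    rw [Measure.map_apply hc (by simp), Measure.map_apply (by fun_prop) (by simp)]
    have h1 : (fun k : ℕ => (k : ℕ∞)) ⁻¹' {(k : ℕ∞)} = {k} := by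
      ext; simp
    rw [h1, ← hX.count_law B hB hfin.lt_top k]
    rfl
  have : IsProbabilityMeasure (P.map (count X B)) :=
    Measure.isProbabilityMeasure_map hc.aemeasurable
  have : IsProbabilityMeasure ((poissonMeasure (μ B).toNNReal).map (fun k : ℕ => (k : ℕ∞))) :=
    Measure.isProbabilityMeasure_map (by fun_prop)
  refine Measure.ext_of_singleton fun k => ?_
  induction k using ENat.recTopCoe with
  | coe k => exact h0 k
  | top =>
    have h1 : ({⊤} : Set ℕ∞) = (⋃ k : ℕ, {(k : ℕ∞)})ᶜ := by
      ext k
      induction k using ENat.recTopCoe <;> simp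
    have hd : Pairwise (Function.onFun Disjoint fun k : ℕ => ({(k : ℕ∞)} : Set ℕ∞)) :=
      fun i j hij => by simpa using hij
    rw [h1, prob_compl_eq_one_sub (by measurability), prob_compl_eq_one_sub (by measurability),
      measure_iUnion hd (fun _ => by simp), measure_iUnion hd (fun _ => by simp), tsum_congr h0]

lemma lintegral_comp_count {B : Set E} (hB : MeasurableSet B) (hfin : μ B ≠ ∞)
    (f : ℕ∞ → ℝ≥0∞) :
    ∫⁻ ω, f (count X B ω) ∂P = ∫⁻ k, f (k : ℕ) ∂(poissonMeasure (μ B).toNNReal) := by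
  rw [← lintegral_map (measurable_of_countable f) (measurable_count hX.measurable hB),
    hX.map_count hB hfin, lintegral_map (measurable_of_countable f) (by fun_prop)]

lemma ae_count_ne_top {B : Set E} (hB : MeasurableSet B) (hfin : μ B ≠ ∞) :
    ∀ᵐ ω ∂P, count X B ω ≠ ⊤ := by
  have h := hX.map_count hB hfin
  have h2 : ∀ᵐ k ∂(P.map (count X B)), k ≠ ⊤ := by
    rw [h, ae_map_iff (by fun_prop) (MeasurableSet.of_discrete)]
    simp
  exact ae_of_ae_map (measurable_count hX.measurable hB).aemeasurable h2

/-- The Mecke formula for a weight and a product functional that are constant on the cells of a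
finite family of disjoint sets: there it is a computation with independent Poisson counts. -/
lemma mecke_partition {ι : Type*} [Fintype ι] {B : ι → Set E} (hB : ∀ j, MeasurableSet (B j))
    (hd : Pairwise (Function.onFun Disjoint B)) (hfin : ∀ j, μ (B j) ≠ ∞) {u : ι → ℝ≥0∞}
    (hu : ∀ j, u j ≤ 1) (j₀ : ι) :
    ∑' n, ∫⁻ ω, (B j₀).indicator 1 (X n ω) * iprod (fun m => if m = n then 1 else
        ∏ j, (1 - (B j).indicator (fun _ => u j) (X m ω))) ∂P =
      μ (B j₀) * ∏ j, expNeg (u j * μ (B j)) := by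
  classical
  -- the sum over `n` equals the product of `F j` of the count of the cell `B j`
  let F : ι → ℕ∞ → ℝ≥0∞ := fun j k =>
    if j = j₀ then k.toNat * (1 - u j) ^ (k.toNat - 1) else (1 - u j) ^ k.toNat
  have hF (j : ι) : ∫⁻ ω, F j (count X (B j) ω) ∂P =
      (if j = j₀ then μ (B j) else 1) * expNeg (u j * μ (B j)) := by
    rw [hX.lintegral_comp_count (hB j) (hfin j)]
    have := ENNReal.coe_toNNReal (hfin j)
    by_cases hj : j = j₀
    · simp only [F, hj, if_true, ENat.toNat_natCast]
      rw [lintegral_mul_pow_poissonMeasure _ (hu _), ENNReal.coe_toNNReal (hfin _)]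
    · simp only [F, hj, if_false, ENat.toNat_natCast]
      rw [lintegral_pow_poissonMeasure _ (hu _), this, one_mul]
  have hind : iIndepFun (fun j ω => F j (count X (B j) ω)) P := by
    have h1 : iIndepFun (fun j => count X (B j)) P := by
      have e := (Fintype.equivFin ι).symm
      have h := hX.indep _ (fun k => B (e k)) (fun k => hB _)
        (fun a b hab => hd (e.injective.ne hab))
      have := h.precomp e.symm.injective
      simpa [Function.comp_def] using this
    exact h1.comp F fun j => measurable_of_countable _
  have hmeas (j : ι) : Measurable fun ω => F j (count X (B j) ω) :=
    (measurable_of_countable (F j)).comp (measurable_count hX.measurable (hB j))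
  have hprod : ∫⁻ ω, ∏ j, F j (count X (B j) ω) ∂P =
      μ (B j₀) * ∏ j, expNeg (u j * μ (B j)) := by
    rw [lintegral_prod_eq_prod_lintegral_of_indepFun univ _ hind hmeas, prod_congr rfl
      (fun j _ => hF j), prod_mul_distrib, prod_ite_eq' univ j₀]
    simp
  rw [← hprod, ← lintegral_tsum]
  · have hae : ∀ᵐ ω ∂P, ∀ j, count X (B j) ω ≠ ⊤ :=
      ae_all_iff.2 fun j => hX.ae_count_ne_top (hB j) (hfin j)
    refine lintegral_congr_ae (hae.mono fun ω hω => ?_)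
    have hS (j : ι) : {n | X n ω ∈ B j}.Finite := Set.encard_ne_top_iff.1 (hω j)
    have hval (n : ℕ) (hn : X n ω ∈ B j₀) :
        iprod (fun m => if m = n then 1 else
          ∏ j, (1 - (B j).indicator (fun _ => u j) (X m ω))) =
        ∏ j, if j = j₀ then (1 - u j) ^ ((count X (B j) ω).toNat - 1)
          else (1 - u j) ^ (count X (B j) ω).toNat := by
      have hS' (j : ι) : ({n | X n ω ∈ B j} \ {n}).Finite := (hS j).sdiff
      trans iprod (fun m => ∏ j, if m ∈ {n | X n ω ∈ B j} \ {n} then 1 - u j else 1)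
      · congr 1
        ext m
        by_cases hm : m = n
        · simp [hm]
        · simp only [hm, if_false, Set.mem_sdiff, Set.mem_ofPred_eq, Set.mem_singleton_iff,
            not_false_eq_true, and_true]
          refine prod_congr rfl fun j _ => ?_
          by_cases hmj : X m ω ∈ B j <;> simp [hmj]
      · rw [iprod_finsetProd]
        · refine prod_congr rfl fun j _ => ?_
          rw [iprod_ite_const (hS' j) tsub_le_self]
          by_cases hj : j = j₀
          · subst hj
            rw [if_pos rfl, Set.ncard_sdiff_singleton_of_mem (s := {n | X n ω ∈ B j}) hn]
            rfl
          · have : n ∉ {n | X n ω ∈ B j} := fun h =>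
              Set.disjoint_left.1 (hd hj) h hn
            rw [if_neg hj, Set.sdiff_singleton_eq_self this]
            rfl
        · intro j m
          split_ifs <;> simp
    trans ∑' n, (B j₀).indicator 1 (X n ω) * ∏ j, if j = j₀ then
        (1 - u j) ^ ((count X (B j) ω).toNat - 1) else (1 - u j) ^ (count X (B j) ω).toNat
    · refine tsum_congr fun n => ?_
      by_cases hn : X n ω ∈ B j₀
      · rw [hval n hn]
      · simp [hn]
    · rw [ENNReal.tsum_mul_right, ← toENNReal_count]
      have h3 : (count X (B j₀) ω : ℝ≥0∞) =
          ∏ j, if j = j₀ then ((count X (B j₀) ω).toNat : ℝ≥0∞) else 1 := by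
        rw [prod_ite_eq' univ j₀]
        simp only [mem_univ, if_true]
        conv_lhs => rw [← ENat.natCast_toNat (hω j₀)]
        rfl
      rw [h3, ← prod_mul_distrib]
      refine prod_congr rfl fun j _ => ?_
      by_cases hj : j = j₀
      · subst hj; simp [F]
      · simp [F, hj]
  · intro n
    refine ((measurable_one.indicator (hB j₀)).comp (hX.measurable n)).aemeasurable.mul ?_
    refine (measurable_iprod fun m => ?_).aemeasurable
    split_ifs
    · exact measurable_const
    · refine Finset.measurable_fun_prod _ fun j _ => ?_
      exact measurable_const.sub ((measurable_const.indicator (hB j)).comp (hX.measurable m))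

end IsPoissonPointProcess
end Count

/-! ### The Mecke formula -/

section Mecke

variable {Ω E : Type*} [MeasurableSpace Ω] [MeasurableSpace E] {P : Measure Ω}
  {X : ℕ → Ω → E} {μ : Measure E}

/-- Approximation from below by simple functions that vanish off a set of finite measure. -/
lemma exists_simpleFunc_iSup [SigmaFinite μ] {f : E → ℝ≥0∞} (hf : Measurable f) :
    ∃ s : ℕ → SimpleFunc E ℝ≥0∞, Monotone s ∧ (∀ k, μ {x | s k x ≠ 0} ≠ ∞) ∧
      (∀ k x, s k x ≠ ∞) ∧ (∀ k, ∫⁻ x, s k x ∂μ ≠ ∞) ∧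
      (∀ k x, s k x ≤ f x) ∧ ∀ x, ⨆ k, s k x = f x := by
  have hS := measurableSet_spanningSets μ
  have hle (k x) : (SimpleFunc.eapprox f k).restrict (spanningSets μ k) x ≤ f x := by
    rw [SimpleFunc.restrict_apply _ (hS k)]
    exact (Set.indicator_le_self' (fun _ _ => zero_le) x).trans
      ((le_iSup (fun k => SimpleFunc.eapprox f k x) k).trans_eq
        (SimpleFunc.iSup_eapprox_apply hf x))
  have hfin (k : ℕ) :
      μ {x | (SimpleFunc.eapprox f k).restrict (spanningSets μ k) x ≠ 0} < ∞ := by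
    refine (measure_mono fun x hx => ?_).trans_lt (measure_spanningSets_lt_top μ k)
    by_contra h
    exact hx (by rw [SimpleFunc.restrict_apply _ (hS k), Set.indicator_of_notMem h])
  have htop (k x) : (SimpleFunc.eapprox f k).restrict (spanningSets μ k) x ≠ ∞ := by
    rw [SimpleFunc.restrict_apply _ (hS k)]
    exact ((Set.indicator_le_self' (fun _ _ => zero_le) x).trans_lt
      (SimpleFunc.eapprox_lt_top f k x)).ne
  refine ⟨fun k => (SimpleFunc.eapprox f k).restrict (spanningSets μ k), ?_, fun k => (hfin k).ne,
    htop, fun k => ?_, hle, ?_⟩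
  · intro k l hkl x
    simp only [SimpleFunc.restrict_apply _ (hS _)]
    exact Set.indicator_le_indicator_of_subset (monotone_spanningSets μ hkl) (fun _ => zero_le) x
      |>.trans (Set.indicator_le_indicator (SimpleFunc.monotone_eapprox f hkl x))
  · rw [SimpleFunc.lintegral_eq_lintegral]
    refine (SimpleFunc.FinMeasSupp.lintegral_lt_top ?_ (ae_of_all _ (htop k))).ne
    exact SimpleFunc.finMeasSupp_iff_support.2 (hfin k)
  · intro x
    refine le_antisymm (iSup_le fun k => hle k x) ?_
    obtain ⟨K, hK⟩ : ∃ K, x ∈ spanningSets μ K := by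
      have := Set.mem_univ x
      rwa [← iUnion_spanningSets μ, Set.mem_iUnion] at this
    rw [← SimpleFunc.iSup_eapprox_apply hf x]
    refine iSup_le fun k => le_iSup_of_le (k ⊔ K) ?_
    simp only [SimpleFunc.restrict_apply _ (hS _)]
    rw [Set.indicator_of_mem (monotone_spanningSets μ le_sup_right hK)]
    exact SimpleFunc.monotone_eapprox f le_sup_left x

/-- The product over the points other than `X n`, with factors `1 - u`. -/
noncomputable def prodOthers (u : E → ℝ≥0∞) (X : ℕ → Ω → E) (n : ℕ) (ω : Ω) : ℝ≥0∞ :=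
  iprod fun m => if m = n then 1 else 1 - u (X m ω)

lemma prodOthers_le_one {Ω E : Type*} (u : E → ℝ≥0∞) (X : ℕ → Ω → E) (n : ℕ) (ω : Ω) :
    prodOthers u X n ω ≤ 1 := iprod_le_one _

lemma measurable_prodOthers (hX : ∀ n, Measurable (X n)) {u : E → ℝ≥0∞} (hu : Measurable u)
    (n : ℕ) : Measurable (prodOthers u X n) := by
  refine measurable_iprod fun m => ?_
  split_ifs
  · exact measurable_const
  · exact measurable_const.sub (hu.comp (hX m))

lemma measurable_apply_of_countable {f : ℕ → Ω → ℝ≥0∞} (hf : ∀ j, Measurable (f j)) {φ : Ω → ℕ}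
    (hφ : Measurable φ) : Measurable fun ω => f (φ ω) ω := by
  have h : Measurable (Function.uncurry f) := measurable_from_prod_countable_right hf
  have hg : Measurable fun ω => (φ ω, ω) := hφ.prodMk measurable_id
  exact h.comp hg

lemma measurable_prodOthers_countable (hX : ∀ n, Measurable (X n)) {u : ℕ → E → ℝ≥0∞}
    (hu : ∀ j, Measurable (u j)) {φ : E → ℕ} (hφ : Measurable φ) (n : ℕ) :
    Measurable fun ω => prodOthers (u (φ (X n ω))) X n ω := by
  exact measurable_apply_of_countable (f := fun j => prodOthers (u j) X n)
    (fun j => measurable_prodOthers hX (hu j) n) (hφ.comp (hX n))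

lemma prodOthers_iSup {Ω E : Type*} {u : ℕ → E → ℝ≥0∞} (hu : ∀ x, Monotone fun k => u k x)
    (X : ℕ → Ω → E) (n : ℕ) (ω : Ω) :
    prodOthers (fun x => ⨆ k, u k x) X n ω = ⨅ k, prodOthers (u k) X n ω := by
  unfold prodOthers
  rw [← iprod_iInf]
  · congr 1
    ext m
    split_ifs
    · simp
    · exact ENNReal.sub_iSup ENNReal.one_ne_top
  · intro k m
    split_ifs <;> simp
  · intro m k l hkl
    dsimp only
    split_ifs
    · exact le_rfl
    · exact tsub_le_tsub_left (hu _ hkl) 1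

lemma tsum_lintegral_eq_lintegral_prod {f : ℕ → Ω → ℝ≥0∞} [SFinite P]
    (hf : ∀ n, Measurable (f n)) :
    ∑' n, ∫⁻ ω, f n ω ∂P = ∫⁻ z, f z.1 z.2 ∂(Measure.count.prod P) := by
  rw [lintegral_prod _ (measurable_from_prod_countable_right hf).aemeasurable, lintegral_count]

lemma tsum_lintegral_iSup {f : ℕ → ℕ → Ω → ℝ≥0∞} [SFinite P]
    (hf : ∀ k n, Measurable (f k n)) (hmono : ∀ n ω, Monotone fun k => f k n ω) :
    ∑' n, ∫⁻ ω, ⨆ k, f k n ω ∂P = ⨆ k, ∑' n, ∫⁻ ω, f k n ω ∂P := by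
  simp_rw [fun k => tsum_lintegral_eq_lintegral_prod (P := P) (hf k)]
  rw [tsum_lintegral_eq_lintegral_prod (P := P) fun n => .iSup fun k => hf k n,
    lintegral_iSup (f := fun k (z : ℕ × Ω) => f k z.1 z.2)
      (fun k => measurable_from_prod_countable_right (hf k)) fun k l hkl z => hmono _ _ hkl]

lemma tsum_lintegral_iInf {f : ℕ → ℕ → Ω → ℝ≥0∞} [SFinite P]
    (hf : ∀ k n, Measurable (f k n)) (hanti : ∀ n ω, Antitone fun k => f k n ω)
    (h0 : ∑' n, ∫⁻ ω, f 0 n ω ∂P ≠ ∞) :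
    ∑' n, ∫⁻ ω, ⨅ k, f k n ω ∂P = ⨅ k, ∑' n, ∫⁻ ω, f k n ω ∂P := by
  rw [tsum_lintegral_eq_lintegral_prod (P := P) (hf 0)] at h0
  simp_rw [fun k => tsum_lintegral_eq_lintegral_prod (P := P) (hf k)]
  rw [tsum_lintegral_eq_lintegral_prod (P := P) fun n => .iInf fun k => hf k n,
    lintegral_iInf (f := fun k (z : ℕ × Ω) => f k z.1 z.2)
      (fun k => measurable_from_prod_countable_right (hf k)) (fun k l hkl z => hanti _ _ hkl) h0]

namespace IsPoissonPointProcess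

variable [IsProbabilityMeasure P] (hX : IsPoissonPointProcess P X μ)
include hX

/-- The Mecke formula for simple functions: the common refinement of their level sets is a finite
partition. -/
lemma mecke_simpleFunc (w u : SimpleFunc E ℝ≥0∞) (hw : μ {x | w x ≠ 0} ≠ ∞)
    (hu : μ {x | u x ≠ 0} ≠ ∞) (hu1 : ∀ x, u x ≤ 1) :
    ∑' n, ∫⁻ ω, w (X n ω) * prodOthers u X n ω ∂P = (∫⁻ x, w x ∂μ) * expNeg (∫⁻ x, u x ∂μ) := by
  classical
  -- the cells are the level sets of `(u, w)`, other than that of `0` and the empty ones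
  let v := u.pair w
  let ι := {z : v.range // (z : ℝ≥0∞ × ℝ≥0∞) ≠ 0 ∧ (z : ℝ≥0∞ × ℝ≥0∞).1 ≤ 1}
  let B : ι → Set E := fun z => v ⁻¹' {z.1.1}
  have hB (z : ι) : MeasurableSet (B z) := v.measurableSet_preimage _
  have hd : Pairwise (Function.onFun Disjoint B) := fun a b hab =>
    Disjoint.preimage _ (by
      simp only [Set.disjoint_singleton]
      exact fun h => hab (Subtype.ext (Subtype.ext h)))
  have hfin (z : ι) : μ (B z) ≠ ∞ := by
    refine ((measure_mono (fun x hx => ?_)).trans_lt ((measure_union_le _ _).trans_lt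
      (ENNReal.add_lt_top.2 ⟨hw.lt_top, hu.lt_top⟩))).ne
    by_contra h
    simp only [Set.mem_union, Set.mem_ofPred_eq, not_or, not_not] at h
    refine z.2.1 ?_
    rw [← show v x = z.1.1 from hx]
    exact Prod.ext h.2 h.1
  have hsum (g : ℝ≥0∞ × ℝ≥0∞ → ℝ≥0∞) (hg : g 0 = 0) (x : E) :
      g (v x) = ∑ z : ι, (B z).indicator (fun _ => g z.1.1) x := by
    by_cases hx : v x = 0
    · rw [hx, hg, sum_eq_zero]
      intro z _
      refine Set.indicator_of_notMem (fun h => z.2.1 ?_) _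
      rw [← show v x = z.1.1 from h, hx]
    · let z₀ : ι := ⟨⟨v x, v.mem_range_self x⟩, hx, hu1 x⟩
      have hz₀ : x ∈ B z₀ := rfl
      rw [sum_eq_single z₀]
      · exact (Set.indicator_of_mem hz₀ fun _ => g (v x)).symm
      · intro z _ hz
        refine Set.indicator_of_notMem (fun h => hz ?_) _
        exact Subtype.ext (Subtype.ext (Eq.symm h))
      · simp
  have hint (g : ℝ≥0∞ × ℝ≥0∞ → ℝ≥0∞) (hg : g 0 = 0) :
      ∫⁻ x, g (v x) ∂μ = ∑ z : ι, g z.1.1 * μ (B z) := by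
    simp_rw [hsum g hg]
    rw [lintegral_finsetSum _ fun z _ => measurable_const.indicator (hB z)]
    exact sum_congr rfl fun z _ => lintegral_indicator_const (hB z) _
  have hu2 (x : E) : 1 - u x = ∏ z : ι, (1 - (B z).indicator (fun _ => z.1.1.1) x) := by
    by_cases hx : v x = 0
    · have : u x = 0 := congrArg Prod.fst hx
      rw [this, prod_eq_one, tsub_zero]
      intro z _
      rw [Set.indicator_of_notMem, tsub_zero]
      exact fun h => z.2.1 (by rw [← show v x = z.1.1 from h, hx])
    · let z₀ : ι := ⟨⟨v x, v.mem_range_self x⟩, hx, hu1 x⟩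
      have hz₀ : x ∈ B z₀ := rfl
      rw [prod_eq_single z₀]
      · rw [Set.indicator_of_mem hz₀]
        rfl
      · intro z _ hz
        rw [Set.indicator_of_notMem, tsub_zero]
        exact fun h => hz (Subtype.ext (Subtype.ext (Eq.symm h)))
      · simp
  have hmain (z : ι) := hX.mecke_partition hB hd hfin (u := fun z => z.1.1.1) (fun z => z.2.2) z
  have hpo (n : ℕ) (ω : Ω) : prodOthers u X n ω = iprod (fun m => if m = n then 1 else
        ∏ z : ι, (1 - (B z).indicator (fun _ => z.1.1.1) (X m ω))) := by
    unfold prodOthers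
    simp_rw [hu2]
  have hE : expNeg (∫⁻ x, u x ∂μ) = ∏ z : ι, expNeg (z.1.1.1 * μ (B z)) := by
    rw [← expNeg_sum, ← hint Prod.fst rfl]
    rfl
  calc ∑' n, ∫⁻ ω, w (X n ω) * prodOthers u X n ω ∂P
      = ∑' n, ∑ z : ι, z.1.1.2 * ∫⁻ ω, (B z).indicator 1 (X n ω) * prodOthers u X n ω ∂P := by
        refine tsum_congr fun n => ?_
        have hm (z : ι) : Measurable fun ω => (B z).indicator 1 (X n ω) * prodOthers u X n ω :=
          ((measurable_one.indicator (hB z)).comp (hX.measurable n)).mul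
            (measurable_prodOthers hX.measurable u.measurable n)
        simp_rw [← lintegral_const_mul _ (hm _)]
        rw [← lintegral_finsetSum _ fun z _ => (hm z).const_mul _]
        refine lintegral_congr fun ω => ?_
        rw [show w (X n ω) = Prod.snd (v (X n ω)) from rfl, hsum Prod.snd rfl, sum_mul]
        refine sum_congr rfl fun z _ => ?_
        by_cases h : X n ω ∈ B z <;> simp [h]
    _ = ∑ z : ι, z.1.1.2 * (μ (B z) * expNeg (∫⁻ x, u x ∂μ)) := by
        rw [Summable.tsum_finsetSum (fun _ _ => ENNReal.summable)]
        refine sum_congr rfl fun z _ => ?_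
        rw [ENNReal.tsum_mul_left, hE, ← hmain z]
        simp_rw [hpo]
    _ = _ := by
        rw [show ∫⁻ x, w x ∂μ = _ from hint Prod.snd rfl, sum_mul]
        simp_rw [mul_assoc]

/-- The Mecke formula for a product functional that does not depend on the distinguished point. -/
lemma mecke_prod [SigmaFinite μ] {w u : E → ℝ≥0∞} (hw : Measurable w) (hu : Measurable u)
    (hu1 : ∀ x, u x ≤ 1) :
    ∑' n, ∫⁻ ω, w (X n ω) * prodOthers u X n ω ∂P = (∫⁻ x, w x ∂μ) * expNeg (∫⁻ x, u x ∂μ) := by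
  obtain ⟨s, hs, hs0, hsf, hsi, hsle, hsup⟩ := exists_simpleFunc_iSup (μ := μ) hw
  obtain ⟨t, ht, ht0, -, -, htle, htup⟩ := exists_simpleFunc_iSup (μ := μ) hu
  have hmeas (k l n : ℕ) : Measurable fun ω => s k (X n ω) * prodOthers (t l) X n ω :=
    ((s k).measurable.comp (hX.measurable n)).mul
      (measurable_prodOthers hX.measurable (t l).measurable n)
  -- the product functional is a decreasing limit, for a weight that is simple
  have h1 (k : ℕ) : ∑' n, ∫⁻ ω, s k (X n ω) * prodOthers u X n ω ∂P =
      (∫⁻ x, s k x ∂μ) * expNeg (∫⁻ x, u x ∂μ) := by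
    have h2 (l : ℕ) := hX.mecke_simpleFunc (s k) (t l) (hs0 k) (ht0 l)
      fun x => (htle l x).trans (hu1 x)
    have htm (x : E) : Monotone fun l => t l x := fun i j hij => ht hij x
    have h3 (n : ℕ) (ω : Ω) : s k (X n ω) * prodOthers u X n ω =
        ⨅ l, s k (X n ω) * prodOthers (t l) X n ω := by
      rw [show u = fun x => ⨆ l, t l x from funext fun x => (htup x).symm,
        prodOthers_iSup htm, ENNReal.mul_iInf (fun h => absurd h (hsf k _))]
    simp_rw [h3]
    rw [tsum_lintegral_iInf (hmeas k)]
    · simp_rw [h2]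
      rw [← ENNReal.mul_iInf (fun h => absurd h (hsi k)), ← expNeg_iSup _ inferInstance,
        ← lintegral_iSup (fun l => (t l).measurable) (fun i j hij x => ht hij x)]
      simp_rw [htup]
    · intro n ω i j hij
      dsimp only
      gcongr
      refine iprod_mono fun m => ?_
      split_ifs
      · exact le_rfl
      · exact tsub_le_tsub_left (ht hij _) 1
    · rw [h2]
      exact ENNReal.mul_ne_top (hsi k) (expNeg_ne_top _)
  have h3 (n : ℕ) (ω : Ω) : w (X n ω) * prodOthers u X n ω =
      ⨆ k, s k (X n ω) * prodOthers u X n ω := by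
    rw [← hsup, ENNReal.iSup_mul]
  simp_rw [h3]
  rw [tsum_lintegral_iSup]
  · simp_rw [h1]
    rw [← ENNReal.iSup_mul, ← lintegral_iSup (fun l => (s l).measurable)
      (fun i j hij x => hs hij x)]
    simp_rw [hsup]
  · exact fun k n => ((s k).measurable.comp (hX.measurable n)).mul
      (measurable_prodOthers hX.measurable hu n)
  · exact fun n ω i j hij => mul_le_mul_left (hs hij _) _

/-- Campbell's formula. -/
lemma tsum_lintegral [SigmaFinite μ] {w : E → ℝ≥0∞} (hw : Measurable w) :
    ∑' n, ∫⁻ ω, w (X n ω) ∂P = ∫⁻ x, w x ∂μ := by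
  simpa [prodOthers] using hX.mecke_prod hw measurable_zero (fun _ => zero_le)

/-- The Mecke formula for a product functional that depends on the distinguished point through
countably many values. -/
lemma mecke_countable [SigmaFinite μ] {w : E → ℝ≥0∞} {u : ℕ → E → ℝ≥0∞} {φ : E → ℕ}
    (hw : Measurable w) (hu : ∀ j, Measurable (u j)) (hu1 : ∀ j x, u j x ≤ 1)
    (hφ : Measurable φ) :
    ∑' n, ∫⁻ ω, w (X n ω) * prodOthers (u (φ (X n ω))) X n ω ∂P =
      ∫⁻ x, w x * expNeg (∫⁻ y, u (φ x) y ∂μ) ∂μ := by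
  have hA (j : ℕ) : MeasurableSet (φ ⁻¹' {j}) := hφ (measurableSet_singleton j)
  have hwj (j : ℕ) : Measurable ((φ ⁻¹' {j}).indicator w) := hw.indicator (hA j)
  have key (f : ℕ → ℝ≥0∞) (x : E) : w x * f (φ x) =
      ∑' j, (φ ⁻¹' {j}).indicator w x * f j := by
    rw [tsum_eq_single (φ x)]
    · rw [Set.indicator_of_mem (by simp)]
    · intro j hj
      rw [Set.indicator_of_notMem (by simpa using hj.symm), zero_mul]
  have h1 (n : ℕ) (ω : Ω) := key (fun j => prodOthers (u j) X n ω) (X n ω)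
  have h2 (x : E) := key (fun j => expNeg (∫⁻ y, u j y ∂μ)) x
  simp_rw [h1, h2]
  rw [lintegral_tsum fun j => ((hwj j).mul_const _).aemeasurable]
  have h3 (n : ℕ) : ∫⁻ ω, ∑' j, (φ ⁻¹' {j}).indicator w (X n ω) * prodOthers (u j) X n ω ∂P =
      ∑' j, ∫⁻ ω, (φ ⁻¹' {j}).indicator w (X n ω) * prodOthers (u j) X n ω ∂P :=
    lintegral_tsum fun j => (((hwj j).comp (hX.measurable n)).mul
      (measurable_prodOthers hX.measurable (hu j) n)).aemeasurable
  simp_rw [h3]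
  rw [ENNReal.tsum_comm]
  refine tsum_congr fun j => ?_
  rw [hX.mecke_prod (hwj j) (hu j) (hu1 j), lintegral_mul_const _ (hwj j)]

/-- The Mecke formula for a product functional that depends on the distinguished point `x`
through `R x ≥ 0`, monotonically and left-continuously. It is the limit of the case of a countable
dependence, `R` being rounded down to multiples of `2 ^ (-k)`. -/
lemma mecke_monotone [SigmaFinite μ] {w : E → ℝ≥0∞} {u : ℝ → E → ℝ≥0∞} {R : E → ℝ}
    (hw : Measurable w) (hwt : ∀ x, w x ≠ ∞) (hwi : ∫⁻ x, w x ∂μ ≠ ∞)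
    (hu : ∀ r, Measurable (u r)) (hu1 : ∀ r, 0 ≤ r → ∀ x, u r x ≤ 1)
    (hmono : ∀ x, MonotoneOn (fun r => u r x) (Set.Ici 0))
    (hcont : ∀ x r, 0 ≤ r → ContinuousWithinAt (fun s => u s x) (Set.Icc 0 r) r)
    (hR : Measurable R) (hR0 : ∀ x, 0 ≤ R x) :
    ∑' n, ∫⁻ ω, w (X n ω) * prodOthers (u (R (X n ω))) X n ω ∂P =
      ∫⁻ x, w x * expNeg (∫⁻ y, u (R x) y ∂μ) ∂μ := by
  -- `ρ k x` is `R x` rounded down to a multiple of `2 ^ (-k)`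
  let φ : ℕ → E → ℕ := fun k x => ⌊2 ^ k * R x⌋₊
  let ρ : ℕ → E → ℝ := fun k x => φ k x / 2 ^ k
  have hφ (k : ℕ) : Measurable (φ k) := Nat.measurable_floor.comp (hR.const_mul _)
  have hρ0 (k x) : 0 ≤ ρ k x := by positivity
  have hρle (k x) : ρ k x ≤ R x := by
    rw [div_le_iff₀' (by positivity)]
    exact Nat.floor_le (mul_nonneg (by positivity) (hR0 x))
  have hρm (x) : Monotone fun k => ρ k x := by
    refine monotone_nat_of_le_succ fun k => ?_
    rw [div_le_div_iff₀ (by positivity) (by positivity), pow_succ']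
    have : 2 * φ k x ≤ φ (k + 1) x := by
      refine Nat.le_floor ?_
      push_cast
      rw [pow_succ', mul_assoc]
      gcongr
      exact Nat.floor_le (mul_nonneg (by positivity) (hR0 x))
    have h : (2 * φ k x : ℝ) ≤ φ (k + 1) x := by exact_mod_cast this
    have h2 : (0 : ℝ) < 2 ^ k := by positivity
    nlinarith
  have hρt (x) : Tendsto (fun k => ρ k x) atTop (𝓝 (R x)) := by
    have h1 : Tendsto (fun k : ℕ => R x - (1 / 2) ^ k) atTop (𝓝 (R x - 0)) :=
      tendsto_const_nhds.sub (tendsto_pow_atTop_nhds_zero_of_lt_one (by norm_num) (by norm_num))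
    rw [sub_zero] at h1
    refine tendsto_of_tendsto_of_tendsto_of_le_of_le h1 tendsto_const_nhds (fun k => ?_)
      fun k => hρle k x
    have h2 : (2 : ℝ) ^ k * R x < φ k x + 1 := Nat.lt_floor_add_one _
    dsimp only
    rw [show ρ k x = φ k x / 2 ^ k from rfl, le_div_iff₀ (by positivity), sub_mul, ← mul_pow]
    norm_num
    linarith
  have hum (x y) : Monotone fun k => u (ρ k x) y := fun i j hij =>
    hmono y (hρ0 i x) (hρ0 j x) (hρm x hij)
  have hsup (x y) : u (R x) y = ⨆ k, u (ρ k x) y := by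
    refine tendsto_nhds_unique ?_ (tendsto_atTop_iSup (hum x y))
    exact (hcont y (R x) (hR0 x)).tendsto.comp (tendsto_nhdsWithin_iff.2
      ⟨hρt x, Eventually.of_forall fun k => ⟨hρ0 k x, hρle k x⟩⟩)
  have hk (k : ℕ) : ∑' n, ∫⁻ ω, w (X n ω) * prodOthers (u (ρ k (X n ω))) X n ω ∂P =
      ∫⁻ x, w x * expNeg (∫⁻ y, u (ρ k x) y ∂μ) ∂μ :=
    hX.mecke_countable (u := fun j => u (j / 2 ^ k)) hw (fun _ => hu _)
      (fun _ => hu1 _ (by positivity)) (hφ k)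
  have hle (k : ℕ) : ∫⁻ x, w x * expNeg (∫⁻ y, u (ρ k x) y ∂μ) ∂μ ≠ ∞ :=
    ((lintegral_mono fun x => mul_le_of_le_one_right' (expNeg_le_one _)).trans_lt hwi.lt_top).ne
  have hm (k : ℕ) : Measurable fun x => w x * expNeg (∫⁻ y, u (ρ k x) y ∂μ) := by
    refine hw.mul (measurable_expNeg.comp ?_)
    exact (measurable_of_countable fun j : ℕ => ∫⁻ y, u (j / 2 ^ k) y ∂μ).comp (hφ k)
  have h1 (n : ℕ) (ω : Ω) : w (X n ω) * prodOthers (u (R (X n ω))) X n ω =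
      ⨅ k, w (X n ω) * prodOthers (u (ρ k (X n ω))) X n ω := by
    rw [funext (hsup (X n ω)), prodOthers_iSup (hum _),
      ENNReal.mul_iInf (fun h => absurd h (hwt _))]
  have h2 (x : E) : w x * expNeg (∫⁻ y, u (R x) y ∂μ) =
      ⨅ k, w x * expNeg (∫⁻ y, u (ρ k x) y ∂μ) := by
    simp_rw [hsup x]
    rw [lintegral_iSup (fun k => hu _) (fun i j hij y => hum x y hij), expNeg_iSup _ inferInstance,
      ENNReal.mul_iInf (fun h => absurd h (hwt _))]
  simp_rw [h1, h2]
  rw [tsum_lintegral_iInf, lintegral_iInf hm _ (hle 0)]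
  · simp_rw [hk]
  · intro i j hij x
    dsimp only
    gcongr
    exact antitone_expNeg (lintegral_mono fun y => hum x y hij)
  · intro k n
    have := measurable_prodOthers_countable hX.measurable (u := fun j => u (j / 2 ^ k))
      (fun j => hu _) (hφ k) n
    exact (hw.comp (hX.measurable n)).mul this
  · intro n ω i j hij
    dsimp only
    gcongr
    refine iprod_mono fun m => ?_
    split_ifs
    · exact le_rfl
    · exact tsub_le_tsub_left (hum _ _ hij) 1
  · rw [hk]
    exact hle 0

end IsPoissonPointProcess
end Mecke

/-! ### Poisson processes in the plane -/

section Plane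

variable {Ω : Type*} [MeasurableSpace Ω] {P : Measure Ω} [IsProbabilityMeasure P]
  {X : ℕ → Ω → Plane} {lam : ℝ}

lemma volume_ball_plane (r : ℝ) (hr : 0 ≤ r) :
    volume (Metric.ball (0 : Plane) r) = ENNReal.ofReal (Real.pi * r ^ 2) := by
  rw [EuclideanSpace.volume_ball_fin_two, ← ENNReal.ofReal_pow hr, mul_comm,
    ENNReal.ofReal_mul Real.pi_pos.le]

/-- Annuli whose squared radii differ by `2 ^ (-k)`. -/
lemma volume_annulus_le (k j : ℕ) :
    volume {x : Plane | ⌊2 ^ k * ‖x‖ ^ 2⌋₊ = j} ≤ ENNReal.ofReal (Real.pi / 2 ^ k) := by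
  have hk : (0 : ℝ) < 2 ^ k := by positivity
  calc volume {x : Plane | ⌊2 ^ k * ‖x‖ ^ 2⌋₊ = j}
      ≤ volume (Metric.ball (0 : Plane) √((j + 1) / 2 ^ k) \
          Metric.ball (0 : Plane) √(j / 2 ^ k)) := by
        refine measure_mono fun x hx => ?_
        have h := (Nat.floor_eq_iff (by positivity)).1 hx
        simp only [Set.mem_sdiff, Metric.mem_ball, dist_zero_right, not_lt]
        constructor
        · refine Real.lt_sqrt_of_sq_lt ?_
          rw [lt_div_iff₀' hk]
          exact h.2
        · refine Real.sqrt_le_iff.2 ⟨norm_nonneg _, ?_⟩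
          rw [div_le_iff₀' hk]
          exact h.1
    _ = ENNReal.ofReal (Real.pi / 2 ^ k) := by
        rw [measure_sdiff (Metric.ball_subset_ball (Real.sqrt_le_sqrt (by gcongr; linarith)))
          Metric.isOpen_ball.nullMeasurableSet measure_ball_lt_top.ne,
          volume_ball_plane _ (Real.sqrt_nonneg _), volume_ball_plane _ (Real.sqrt_nonneg _),
          Real.sq_sqrt (by positivity), Real.sq_sqrt (by positivity),
          ← ENNReal.ofReal_sub _ (by positivity)]
        congr 1
        ring

instance sigmaFinite_ofReal_smul (lam : ℝ) :
    SigmaFinite (ENNReal.ofReal lam • (volume : Measure Plane)) :=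
  inferInstanceAs (SigmaFinite (Real.toNNReal lam • (volume : Measure Plane)))

namespace IsPoissonPointProcess

variable (hX : IsPoissonPointProcess P X (ENNReal.ofReal lam • (volume : Measure Plane)))
include hX

/-- Almost surely no two points are at the same distance from the origin. By the Mecke formula, the
expected number of the points of a ball that share a thin annulus with another point is at most
the volume of the ball times that of the annulus. -/
lemma ae_norm_injective : ∀ᵐ ω ∂P, ∀ n m, m ≠ n → ‖X m ω‖ ≠ ‖X n ω‖ := by
  set μ : Measure Plane := ENNReal.ofReal lam • (volume : Measure Plane) with hμ
  have key (K : ℕ) : ∀ᵐ ω ∂P, ∀ n, ¬ (X n ω ∈ Metric.ball 0 (K : ℝ) ∧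
      ∃ m, m ≠ n ∧ ‖X m ω‖ = ‖X n ω‖) := by
    have hXn (n) : Measurable fun ω => ‖X n ω‖ := (hX.measurable n).norm
    let T : ℕ → Set Ω := fun n => {ω | X n ω ∈ Metric.ball 0 (K : ℝ) ∧
      ∃ m, m ≠ n ∧ ‖X m ω‖ = ‖X n ω‖}
    have hT (n) : MeasurableSet (T n) := by
      have h1 : MeasurableSet {ω | ∃ m, m ≠ n ∧ ‖X m ω‖ = ‖X n ω‖} := by
        rw [show {ω | ∃ m, m ≠ n ∧ ‖X m ω‖ = ‖X n ω‖} = ⋃ m, {ω | m ≠ n ∧ ‖X m ω‖ = ‖X n ω‖} by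
          ext; simp]
        exact .iUnion fun m => (MeasurableSet.const _).inter (measurableSet_eq_fun (hXn m) (hXn n))
      exact ((hX.measurable n) measurableSet_ball).inter h1
    have hball : MeasurableSet (Metric.ball (0 : Plane) (K : ℝ)) := measurableSet_ball
    have hwm : Measurable ((Metric.ball (0 : Plane) (K : ℝ)).indicator (1 : Plane → ℝ≥0∞)) :=
      measurable_one.indicator hball
    have hbfin : μ (Metric.ball (0 : Plane) (K : ℝ)) ≠ ∞ := by
      rw [hμ, Measure.smul_apply, smul_eq_mul]
      exact ENNReal.mul_ne_top ENNReal.ofReal_ne_top measure_ball_lt_top.ne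
    have hcell (k j : ℕ) : MeasurableSet {x : Plane | ⌊2 ^ k * ‖x‖ ^ 2⌋₊ = j} :=
      (Nat.measurable_floor.comp ((measurable_norm.pow_const 2).const_mul _))
        (measurableSet_singleton j)
    -- the expected number of points that share their annulus with another point
    have hle (k : ℕ) : ∑' n, P (T n) + μ (Metric.ball (0 : Plane) (K : ℝ)) *
        expNeg (ENNReal.ofReal lam * ENNReal.ofReal (Real.pi / 2 ^ k)) ≤
        μ (Metric.ball (0 : Plane) (K : ℝ)) := by
      let φ : Plane → ℕ := fun x => ⌊2 ^ k * ‖x‖ ^ 2⌋₊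
      let u : ℕ → Plane → ℝ≥0∞ := fun j => {x : Plane | φ x = j}.indicator 1
      have hφ : Measurable φ :=
        Nat.measurable_floor.comp ((measurable_norm.pow_const 2).const_mul _)
      have hu (j) : Measurable (u j) := measurable_one.indicator (hcell k j)
      have h1 := hX.mecke_countable (w := (Metric.ball (0 : Plane) (K : ℝ)).indicator 1) hwm hu
        (fun j x => Set.indicator_le_self' (by simp) x) hφ
      have h2 := hX.tsum_lintegral hwm
      rw [lintegral_indicator_one hball] at h2
      calc _ ≤ ∑' n, P (T n) + ∫⁻ x, (Metric.ball (0 : Plane) (K : ℝ)).indicator 1 x *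
            expNeg (∫⁻ y, u (φ x) y ∂μ) ∂μ := by
            gcongr
            rw [← lintegral_indicator_one hball, ← lintegral_mul_const _ hwm]
            refine lintegral_mono fun x => ?_
            gcongr
            refine antitone_expNeg ?_
            simp only [u]
            rw [lintegral_indicator_one (hcell k _), hμ, Measure.smul_apply, smul_eq_mul]
            gcongr
            exact volume_annulus_le k _
        _ = ∑' n, ∫⁻ ω, (T n).indicator 1 ω + (Metric.ball (0 : Plane) (K : ℝ)).indicator 1 (X n ω)
              * prodOthers (u (φ (X n ω))) X n ω ∂P := by
            rw [← h1, ← ENNReal.tsum_add]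
            refine tsum_congr fun n => ?_
            rw [lintegral_add_left (measurable_one.indicator (hT n)),
              lintegral_indicator_one (hT n)]
        _ ≤ ∑' n, ∫⁻ ω, (Metric.ball (0 : Plane) (K : ℝ)).indicator 1 (X n ω) ∂P := by
            refine ENNReal.tsum_le_tsum fun n => lintegral_mono fun ω => ?_
            by_cases hω : ω ∈ T n
            · obtain ⟨hb, m, hm, he⟩ := id hω
              have h0 : prodOthers (u (φ (X n ω))) X n ω = 0 := by
                refine le_antisymm ((iInf_le _ (m + 1)).trans_eq ?_) zero_le
                refine prod_eq_zero (self_mem_range_succ m) ?_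
                rw [if_neg hm]
                simp only [u]
                rw [Set.indicator_of_mem (by simp [φ, he])]
                simp
              rw [h0, mul_zero, add_zero, Set.indicator_of_mem hω, Set.indicator_of_mem hb]
              simp
            · rw [Set.indicator_of_notMem hω, zero_add]
              exact mul_le_of_le_one_right' (prodOthers_le_one _ _ _ _)
        _ = _ := h2
    have hlim : Tendsto (fun k : ℕ => ∑' n, P (T n) + μ (Metric.ball (0 : Plane) (K : ℝ)) *
        expNeg (ENNReal.ofReal lam * ENNReal.ofReal (Real.pi / 2 ^ k))) atTop
        (𝓝 (∑' n, P (T n) + μ (Metric.ball (0 : Plane) (K : ℝ)) * 1)) := by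
      refine tendsto_const_nhds.add (ENNReal.Tendsto.const_mul ?_ (Or.inr hbfin))
      have h0 : Tendsto (fun k : ℕ => ENNReal.ofReal lam * ENNReal.ofReal (Real.pi / 2 ^ k)) atTop
          (𝓝 (ENNReal.ofReal lam * ENNReal.ofReal 0)) := by
        refine ENNReal.Tendsto.const_mul (ENNReal.tendsto_ofReal ?_) (Or.inr ENNReal.ofReal_ne_top)
        exact tendsto_const_nhds.div_atTop (tendsto_pow_atTop_atTop_of_one_lt one_lt_two)
      have h1 := (continuous_expNeg.tendsto _).comp h0
      simpa [Function.comp_def] using h1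
    have h0 : ∑' n, P (T n) = 0 := by
      have := le_of_tendsto' hlim hle
      rw [mul_one] at this
      have h3 : ∑' n, P (T n) + μ (Metric.ball (0 : Plane) (K : ℝ)) ≤
        0 + μ (Metric.ball (0 : Plane) (K : ℝ)) := by simpa using this
      exact le_antisymm ((ENNReal.add_le_add_iff_right hbfin).1 h3) zero_le
    rw [ae_all_iff]
    intro n
    exact measure_eq_zero_iff_ae_notMem.1 (ENNReal.tsum_eq_zero.1 h0 n)
  filter_upwards [ae_all_iff.2 key] with ω hω n m hm he
  obtain ⟨K, hK⟩ := exists_nat_gt ‖X n ω‖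
  exact hω K n ⟨by simpa using hK, m, hm, he⟩

lemma ae_ne_zero : ∀ᵐ ω ∂P, ∀ n, X n ω ≠ 0 := by
  have h := hX.tsum_lintegral (w := ({0} : Set Plane).indicator 1)
    (measurable_one.indicator (measurableSet_singleton 0))
  rw [lintegral_indicator_one (measurableSet_singleton 0), Measure.smul_apply,
    measure_singleton, smul_zero, ENNReal.tsum_eq_zero] at h
  rw [ae_all_iff]
  intro n
  have h1 := h n
  rw [lintegral_eq_zero_iff (f := fun ω => ({0} : Set Plane).indicator 1 (X n ω))
    ((measurable_one.indicator (measurableSet_singleton 0)).comp (hX.measurable n))] at h1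
  filter_upwards [h1] with ω hω h0
  simp [h0] at hω

end IsPoissonPointProcess
end Plane

/-! ### Independence -/

section Independence

variable {Ω β γ : Type*} [MeasurableSpace Ω] [MeasurableSpace β] [MeasurableSpace γ]
  {P : Measure Ω} [IsProbabilityMeasure P]

lemma lintegral_of_indepFun {U : Ω → β} {V : Ω → γ} (hU : Measurable U) (hV : Measurable V)
    (h : IndepFun U V P) {f : β × γ → ℝ≥0∞} (hf : Measurable f) :
    ∫⁻ ω, f (U ω, V ω) ∂P = ∫⁻ ω, ∫⁻ ω', f (U ω, V ω') ∂P ∂P := by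
  rw [← lintegral_map (f := f) hf (hU.prodMk hV),
    (indepFun_iff_map_prod_eq_prod_map_map hU.aemeasurable hV.aemeasurable).1 h,
    lintegral_prod _ hf.aemeasurable, lintegral_map hf.lintegral_prod_right' hU]
  refine lintegral_congr fun ω => ?_
  rw [lintegral_map (f := fun y => f (U ω, y)) (hf.comp measurable_prodMk_left) hV]

lemma indepFun_others {P : Measure Ω} {M : ℕ → Ω → β} (hM : ∀ n, Measurable (M n))
    (hi : iIndepFun M P) (n : ℕ) :
    IndepFun (fun ω (m : {m // m ≠ n}) => M m ω) (M n) P := by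
  have h := indep_iSup_of_disjoint (fun k => (hM k).comap_le) hi.iIndep
    (S := {n}ᶜ) (T := {n}) disjoint_compl_left
  rw [IndepFun_iff_Indep]
  have e1 : MeasurableSpace.comap (fun ω (m : {m // m ≠ n}) => M m ω) MeasurableSpace.pi =
      ⨆ k ∈ ({n}ᶜ : Set ℕ), MeasurableSpace.comap (M k) inferInstance := by
    rw [MeasurableSpace.pi, MeasurableSpace.comap_iSup, iSup_subtype']
    simp_rw [MeasurableSpace.comap_comp]
    rfl
  rw [e1]
  simpa using h

/-- The variable `M n` may be replaced by an independent copy in a functional of `M n` and the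
other variables. -/
lemma lintegral_of_iIndepFun {M : ℕ → Ω → β} (hM : ∀ n, Measurable (M n)) (hi : iIndepFun M P)
    (n : ℕ) {f : (ℕ → β) × β → ℝ≥0∞} (hf : Measurable f)
    (hn : ∀ y z z', f (Function.update y n z', z) = f (y, z)) :
    ∫⁻ ω, f (fun m => M m ω, M n ω) ∂P = ∫⁻ ω, ∫⁻ ω', f (fun m => M m ω, M n ω') ∂P ∂P := by
  obtain ⟨ω₀⟩ : Nonempty Ω := nonempty_of_isProbabilityMeasure P
  let e : ({m // m ≠ n} → β) → ℕ → β := fun y m => if h : m = n then M n ω₀ else y ⟨m, h⟩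
  have he : Measurable e := by
    refine measurable_pi_iff.2 fun m => ?_
    by_cases h : m = n
    · simp only [e, h, dif_pos]; exact measurable_const
    · simp only [e, h, dif_neg, not_false_eq_true]; fun_prop
  have hfe (ω : Ω) (z : β) : f (fun m => M m ω, z) = f (e fun m => M m ω, z) := by
    rw [← hn _ z (M n ω₀)]
    congr 2
    ext m
    by_cases h : m = n
    · subst h; simp [e]
    · simp [e, h]
  simp_rw [hfe]
  exact lintegral_of_indepFun (f := fun z => f (e z.1, z.2)) (by fun_prop) (hM n)
    (indepFun_others hM hi n) (hf.comp ((he.comp measurable_fst).prodMk measurable_snd))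

end Independence

/-! ### Gamma and exponential laws -/

lemma ofReal_exp_mul_gammaPDF {a b l : ℝ} (hb : 0 < b) (hl : 0 ≤ l) (x : ℝ) :
    ENNReal.ofReal (Real.exp (-(l * x))) * gammaPDF a b x =
      ENNReal.ofReal ((b / (b + l)) ^ a) * gammaPDF a (b + l) x := by
  rcases lt_or_ge x 0 with hx | hx
  · simp [gammaPDF_of_neg hx]
  · have hbl : 0 < b + l := by linarith
    rw [gammaPDF_of_nonneg hx, gammaPDF_of_nonneg hx, ← ENNReal.ofReal_mul (by positivity),
      ← ENNReal.ofReal_mul (by positivity)]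
    congr 1
    rw [Real.div_rpow hb.le hbl.le, show -((b + l) * x) = -(l * x) + -(b * x) by ring, Real.exp_add]
    have : (b + l) ^ a ≠ 0 := (Real.rpow_pos_of_pos hbl a).ne'
    field_simp

/-- Exponential tilting of a Gamma law changes its rate. -/
lemma setLIntegral_exp_gammaMeasure {a b l : ℝ} (hb : 0 < b) (hl : 0 ≤ l) {S : Set ℝ}
    (hS : MeasurableSet S) :
    ∫⁻ x in S, ENNReal.ofReal (Real.exp (-(l * x))) ∂(gammaMeasure a b) =
      ENNReal.ofReal ((b / (b + l)) ^ a) * gammaMeasure a (b + l) S := by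
  have hm (c : ℝ) : Measurable (gammaPDF a c) := (measurable_gammaPDFReal a c).ennreal_ofReal
  rw [gammaMeasure, gammaMeasure, withDensity_apply _ hS,
    setLIntegral_withDensity_eq_setLIntegral_mul _ (hm b) (by fun_prop) hS,
    ← lintegral_const_mul _ (hm _)]
  refine lintegral_congr fun x => ?_
  rw [← ofReal_exp_mul_gammaPDF hb hl, Pi.mul_apply, mul_comm]

lemma upperGamma_zero_sub {a T : ℝ} (ha : 0 < a) (hT : 0 ≤ T) :
    upperGamma a 0 - upperGamma a T = ∫ t in (0 : ℝ)..T, t ^ (a - 1) * Real.exp (-t) := by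
  have h := Real.GammaIntegral_convergent ha
  have h' : IntegrableOn (fun t : ℝ => t ^ (a - 1) * Real.exp (-t)) (Set.Ioi 0) :=
    h.congr_fun (fun t _ => mul_comm _ _) measurableSet_Ioi
  rw [upperGamma, upperGamma, intervalIntegral.integral_Ioi_sub_Ioi h' hT]

lemma gammaMeasure_Icc {a b T : ℝ} (ha : 0 < a) (hb : 0 < b) (hT : 0 ≤ T) :
    gammaMeasure a b (Set.Icc 0 T) =
      ENNReal.ofReal ((upperGamma a 0 - upperGamma a (b * T)) / Real.Gamma a) := by
  have hT' : 0 ≤ b * T := by positivity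
  have h := Real.GammaIntegral_convergent ha
  have h' : IntegrableOn (fun t : ℝ => t ^ (a - 1) * Real.exp (-t)) (Set.Ioc 0 (b * T)) :=
    (h.congr_fun (fun t _ => mul_comm _ _) measurableSet_Ioi).mono_set Set.Ioc_subset_Ioi_self
  have h2 : IntervalIntegrable (fun t : ℝ => t ^ (a - 1) * Real.exp (-t)) volume 0 (b * T) :=
    (intervalIntegrable_iff_integrableOn_Ioc_of_le hT').2 h'
  have h3 : IntervalIntegrable (fun x : ℝ => (b * x) ^ (a - 1) * Real.exp (-(b * x)))
      volume 0 T := by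
    have := h2.comp_mul_left (c := b)
    simpa [hb.ne'] using this
  have hcongr (x : ℝ) (hx : x ∈ Set.Ioc 0 T) : gammaPDFReal a b x =
      b / Real.Gamma a * ((b * x) ^ (a - 1) * Real.exp (-(b * x))) := by
    have hx0 : 0 < x := hx.1
    rw [gammaPDFReal, if_pos hx0.le, Real.mul_rpow hb.le hx0.le, Real.rpow_sub_one hb.ne']
    field_simp
  have hint : IntegrableOn (gammaPDFReal a b) (Set.Ioc 0 T) := by
    refine IntegrableOn.congr_fun ?_ (fun x hx => (hcongr x hx).symm) measurableSet_Ioc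
    exact ((intervalIntegrable_iff_integrableOn_Ioc_of_le hT).1 h3).const_mul _
  rw [gammaMeasure, withDensity_apply _ measurableSet_Icc, setLIntegral_congr Ioc_ae_eq_Icc.symm]
  simp only [gammaPDF]
  rw [← ofReal_integral_eq_lintegral_ofReal hint
    (ae_of_all _ fun x => gammaPDFReal_nonneg ha hb x),
    setIntegral_congr_fun measurableSet_Ioc hcongr, integral_const_mul,
    ← intervalIntegral.integral_of_le hT,
    intervalIntegral.integral_comp_mul_left (fun t => t ^ (a - 1) * Real.exp (-t)) hb.ne',
    mul_zero, ← upperGamma_zero_sub ha hT', smul_eq_mul]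
  congr 1
  field_simp

lemma upperGamma_zero_sub_pos {a T : ℝ} (ha : 0 < a) (hT : 0 < T) :
    0 < upperGamma a 0 - upperGamma a T := by
  have h := Real.GammaIntegral_convergent ha
  have h' : IntegrableOn (fun t : ℝ => t ^ (a - 1) * Real.exp (-t)) (Set.Ioc 0 T) :=
    (h.congr_fun (fun t _ => mul_comm _ _) measurableSet_Ioi).mono_set Set.Ioc_subset_Ioi_self
  rw [upperGamma_zero_sub ha hT.le]
  refine intervalIntegral.intervalIntegral_pos_of_pos_on
    ((intervalIntegrable_iff_integrableOn_Ioc_of_le hT.le).2 h') (fun x hx => ?_) hT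
  exact mul_pos (Real.rpow_pos_of_pos hx.1 _) (Real.exp_pos _)

lemma expMeasure_le_ofReal (a : ℝ≥0∞) :
    expMeasure 1 {x | a ≤ ENNReal.ofReal x} = expNeg a := by
  have := isProbabilityMeasure_expMeasure one_pos
  have hna : NullSingletonClass (expMeasure 1) := by
    rw [expMeasure, gammaMeasure]; infer_instance
  induction a using ENNReal.recTopCoe with
  | top => simp
  | coe t =>
    rcases eq_or_ne t 0 with rfl | ht
    · simp
    · have ht0 : 0 < (t : ℝ) := by positivity
      have h1 : {x : ℝ | (t : ℝ≥0∞) ≤ ENNReal.ofReal x} = (Set.Iio (t : ℝ))ᶜ := by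
        ext x
        simp [← ENNReal.ofReal_coe_nnreal, ENNReal.ofReal_le_ofReal_iff', ht0]
      have h2 := cdf_expMeasure_eq one_pos (t : ℝ)
      rw [if_pos ht0.le, one_mul, cdf_eq_real] at h2
      rw [h1, prob_compl_eq_one_sub measurableSet_Iio, measure_congr Iio_ae_eq_Iic,
        ← ofReal_measureReal, h2, ← ENNReal.ofReal_coe_nnreal, expNeg_ofReal ht0.le,
        ← ENNReal.ofReal_one, ← ENNReal.ofReal_sub _ (by simp)]
      simp

lemma lintegral_expNeg_expMeasure {s : ℝ} (hs : 0 ≤ s) :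
    ∫⁻ x, expNeg (ENNReal.ofReal s * ENNReal.ofReal x) ∂(expMeasure 1) =
      ENNReal.ofReal (1 / (1 + s)) := by
  have h1 : ∫⁻ x, expNeg (ENNReal.ofReal s * ENNReal.ofReal x) ∂(expMeasure 1) =
      ∫⁻ x in Set.univ, ENNReal.ofReal (Real.exp (-(s * x))) ∂(gammaMeasure 1 1) := by
    rw [setLIntegral_univ, ← expMeasure]
    have h0 : ∀ᵐ x ∂(expMeasure 1), 0 ≤ x := by
      have h2 : {x : ℝ | ¬ 0 ≤ x} = Set.Iio 0 := by ext; simp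
      rw [ae_iff, h2, expMeasure, gammaMeasure, withDensity_apply _ measurableSet_Iio]
      exact (setLIntegral_congr_fun measurableSet_Iio fun x hx => gammaPDF_of_neg hx).trans
        lintegral_zero
    refine lintegral_congr_ae (h0.mono fun x hx => ?_)
    dsimp only
    rw [← ENNReal.ofReal_mul hs, expNeg_ofReal (by positivity)]
  have := isProbabilityMeasure_gammaMeasure one_pos (show 0 < 1 + s by positivity)
  rw [h1, setLIntegral_exp_gammaMeasure one_pos hs .univ, measure_univ, mul_one, Real.rpow_one]

/-! ### The marks of a user -/

namespace Params
variable {N : ℕ} {p : Params N}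

/-- The probability that a user caches file `i` and is a transmitter, defined from the closed form
of `txDensity`; see `Network.Model.measureReal_cached_isTransmitter`. -/
noncomputable def txProb (p : Params N) (i : Fin N) : ℝ := p.txDensity i / p.lam

lemma popularity_nonneg (i : Fin N) : 0 ≤ p.popularity i :=
  div_nonneg (Real.rpow_nonneg (by positivity) _)
    (sum_nonneg fun k _ => Real.rpow_nonneg (by positivity) _)

lemma Admissible.lam_mul_txProb (hp : p.Admissible) (i : Fin N) :
    p.lam * p.txProb i = p.txDensity i := mul_div_cancel₀ _ hp.lam_pos.ne'

section Coverage
variable (hp : p.Admissible) {i : Fin N} (hi : 0 < p.pc i)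
include hp hi

lemma Admissible.helperDensity_pos : 0 < p.helperDensity i := mul_pos hp.lam_pos hi

lemma Admissible.isProbabilityMeasure_coverageLaw : IsProbabilityMeasure (p.coverageLaw i) := by
  have hl := hp.helperDensity_pos hi
  have hrc := hp.rc_pos
  have := isProbabilityMeasure_gammaMeasure (a := 3.5) (r := 3.5 * p.helperDensity i)
    (by norm_num) (by positivity)
  refine cond_isProbabilityMeasure ?_
  rw [gammaMeasure_Icc (by norm_num) (by positivity) (by positivity)]
  refine (ENNReal.ofReal_pos.2 (div_pos (upperGamma_zero_sub_pos (by norm_num) (by positivity))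
    (Real.Gamma_pos_of_pos (by norm_num)))).ne'

lemma no_demand_nonneg :
    0 ≤ (1 + p.lam * p.popularity i / (3.5 * p.helperDensity i)) ^ (-3.5 : ℝ) * p.theta i := by
  have hl := hp.helperDensity_pos hi
  have hrc := hp.rc_pos
  have hlam := hp.lam_pos
  have hpop := p.popularity_nonneg i
  refine mul_nonneg (Real.rpow_nonneg (by positivity) _) (div_nonneg ?_ ?_)
  · exact (upperGamma_zero_sub_pos (by norm_num) (by positivity)).le
  · exact (upperGamma_zero_sub_pos (by norm_num) (by positivity)).le

/-- The probability that no request falls in the coverage area of a helper. -/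
lemma Admissible.lintegral_no_demand :
    ∫⁻ x, poissonMeasure (p.lam * p.popularity i * x).toNNReal {0} ∂(p.coverageLaw i) =
      ENNReal.ofReal ((1 + p.lam * p.popularity i / (3.5 * p.helperDensity i)) ^ (-3.5 : ℝ) *
        p.theta i) := by
  have hl := hp.helperDensity_pos hi
  have hrc := hp.rc_pos
  have hlam := hp.lam_pos
  have hpop := p.popularity_nonneg i
  set b := 3.5 * p.helperDensity i with hb
  have hb0 : 0 < b := by positivity
  set l := p.lam * p.popularity i with hl'
  have hl0 : 0 ≤ l := by positivity
  have hT : 0 < Real.pi * p.rc ^ 2 := by positivity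
  rw [coverageLaw, ← hb, ProbabilityTheory.cond, lintegral_smul_measure, smul_eq_mul]
  have h1 : ∫⁻ x in Set.Icc 0 (Real.pi * p.rc ^ 2), poissonMeasure (l * x).toNNReal {0}
      ∂(gammaMeasure 3.5 b) = ∫⁻ x in Set.Icc 0 (Real.pi * p.rc ^ 2),
        ENNReal.ofReal (Real.exp (-(l * x))) ∂(gammaMeasure 3.5 b) := by
    refine setLIntegral_congr_fun measurableSet_Icc fun x hx => ?_
    rw [poissonMeasure_singleton, Real.coe_toNNReal _ (mul_nonneg hl0 hx.1)]
    simp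
  have hden := upperGamma_zero_sub_pos (a := 3.5) (by norm_num) (mul_pos hb0 hT)
  have hG : 0 < Real.Gamma 3.5 := Real.Gamma_pos_of_pos (by norm_num)
  have hden' : 0 < (upperGamma 3.5 0 - upperGamma 3.5 (b * (Real.pi * p.rc ^ 2))) /
    Real.Gamma 3.5 := div_pos hden hG
  rw [h1, setLIntegral_exp_gammaMeasure hb0 hl0 measurableSet_Icc,
    gammaMeasure_Icc (by norm_num) hb0 hT.le,
    gammaMeasure_Icc (by norm_num) (by positivity) hT.le, ← ENNReal.ofReal_inv_of_pos hden',
    ← ENNReal.ofReal_mul (by positivity), ← ENNReal.ofReal_mul (by positivity)]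
  congr 1
  have h2 : 1 + l / b = (b + l) / b := by field_simp
  rw [theta, ← hb, ← hl', h2, Real.rpow_neg (by positivity), ← Real.inv_rpow (by positivity),
    inv_div]
  field_simp

end Coverage
end Params

section Marks

variable {N : ℕ} {Ω : Type*} [MeasurableSpace Ω] {P : Measure Ω}
    [IsProbabilityMeasure P] {p : Params N} {net : Network N Ω}

namespace Network.Model

variable (hp : p.Admissible) (hnet : net.Model P p)

lemma measurable_cached {P : Measure Ω} (hnet : net.Model P p) (n : ℕ) :
    Measurable (net.cached n) :=
  (hnet.measurable_mark n).fst.fst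

lemma measurable_demand {P : Measure Ω} (hnet : net.Model P p) (n : ℕ) :
    Measurable (net.demand n) :=
  (hnet.measurable_mark n).fst.snd.snd

lemma measurable_gain {P : Measure Ω} (hnet : net.Model P p) (n : ℕ) : Measurable (net.gain n) :=
  (hnet.measurable_mark n).snd

lemma measurableSet_cached {P : Measure Ω} (hnet : net.Model P p) (n : ℕ) (i : Fin N) :
    MeasurableSet {ω | net.cached n ω = i} :=
  hnet.measurable_cached n (measurableSet_singleton i)

lemma measurableSet_isTransmitter {P : Measure Ω} (hnet : net.Model P p) (n : ℕ) :
    MeasurableSet {ω | net.IsTransmitter n ω} :=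
  (hnet.measurable_demand n (measurableSet_singleton 0)).compl

include hp

lemma measure_cached {P : Measure Ω} (hnet : net.Model P p) (n : ℕ) (i : Fin N) :
    P {ω | net.cached n ω = i} = ENNReal.ofReal (p.pc i) := by
  have h1 : {ω | net.cached n ω = i} =
      ⋃ k : ℕ, {ω | net.cached n ω = i ∧ net.area n ω ∈ Set.univ ∧ net.demand n ω = k} := by
    ext; simp
  have hm (k : ℕ) : MeasurableSet
      {ω | net.cached n ω = i ∧ net.area n ω ∈ Set.univ ∧ net.demand n ω = k} := by
    simp only [Set.mem_univ, true_and]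
    exact (hnet.measurableSet_cached n i).inter
      (hnet.measurable_demand n (measurableSet_singleton k))
  rw [h1, measure_iUnion _ hm]
  · simp_rw [hnet.helper_law n i Set.univ _ .univ]
    rw [ENNReal.tsum_mul_left]
    rcases (hp.pc_nonneg i).eq_or_lt with h0 | h0
    · simp [← h0]
    · have := hp.isProbabilityMeasure_coverageLaw h0
      rw [← lintegral_tsum fun k => ?_]
      · have h2 (r : NNReal) : ∑' k : ℕ, poissonMeasure r {k} = 1 := by
          rw [← measure_univ (μ := poissonMeasure r), ← Set.iUnion_of_singleton,
            measure_iUnion (fun a b h => by simpa using h) (fun _ => by simp)]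
        simp [h2]
      · simp_rw [poissonMeasure_singleton]
        fun_prop
  · intro a b hab
    refine Set.disjoint_left.2 fun ω ha hb => hab ?_
    rw [← ha.2.2, ← hb.2.2]

lemma measureReal_cached {P : Measure Ω} (hnet : net.Model P p) (n : ℕ) (i : Fin N) :
    P.real {ω | net.cached n ω = i} = p.pc i := by
  rw [measureReal_def, hnet.measure_cached hp, ENNReal.toReal_ofReal (hp.pc_nonneg i)]

include hnet

/-- Thinning: `txDensity i = λ * txProb i`, where `txProb i` is the probability that a user caches
file `i` and has a nonzero demand. -/
lemma measureReal_cached_isTransmitter (n : ℕ) (i : Fin N) :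
    P.real {ω | net.cached n ω = i ∧ net.IsTransmitter n ω} = p.txProb i := by
  have h0 : {ω | net.cached n ω = i ∧ net.IsTransmitter n ω} = {ω | net.cached n ω = i} \
      {ω | net.cached n ω = i ∧ net.area n ω ∈ Set.univ ∧ net.demand n ω = 0} := by
    ext ω
    simp only [IsTransmitter, Set.mem_univ, true_and, Set.mem_ofPred_eq, Set.mem_sdiff]
    tauto
  have hm : MeasurableSet
      {ω | net.cached n ω = i ∧ net.area n ω ∈ Set.univ ∧ net.demand n ω = 0} := by
    simp only [Set.mem_univ, true_and]
    exact (hnet.measurableSet_cached n i).inter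
      (hnet.measurable_demand n (measurableSet_singleton 0))
  rw [h0, measureReal_sdiff (s₁ := {ω | net.cached n ω = i}) (fun ω h => h.1) hm,
    hnet.measureReal_cached hp, measureReal_def, hnet.helper_law n i _ _ .univ,
    Measure.restrict_univ, Params.txProb, Params.txDensity, Params.helperDensity]
  have hlam := hp.lam_pos
  rcases (hp.pc_nonneg i).eq_or_lt with hpc | hpc
  · simp [← hpc]
  · rw [hp.lintegral_no_demand hpc, ENNReal.toReal_mul, ENNReal.toReal_ofReal hpc.le,
      ENNReal.toReal_ofReal, Params.helperDensity]
    · field_simp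
    · exact p.no_demand_nonneg hp hpc

end Network.Model
end Marks

/-! ### Conditional probability of service, given the locations -/

section Defect

variable {N : ℕ}

open Classical in
/-- The defect `1 - E` of the expected factor `E` by which a user of normalized mean received power
`s` contributes to the offloading probability of file `i`: the user must not cache file `i` if it
is nearer than the serving user (`near`), and it contributes the Laplace transform `1 / (1 + s)` of
its exponential gain if it is a transmitter. -/
noncomputable def defect (p : Params N) (i : Fin N) (near : Prop) (s : ℝ) : ℝ :=
  (∑ j, p.txProb j - p.txProb i) * (s / (1 + s)) +
    if near then p.pc i else p.txProb i * (s / (1 + s))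

/-- The interference at the typical user with respect to user `n`, with weights `a m` in place of
the path losses, as a function of the marks. -/
noncomputable def weightedInterference (a : ℕ → ℝ) (n : ℕ) (y : ℕ → (Fin N × ℝ × ℕ) × ℝ) : ℝ≥0∞ :=
  ∑' m, if m ≠ n ∧ (y m).1.2.2 ≠ 0 then ENNReal.ofReal (a m) * ENNReal.ofReal (y m).2 else 0

lemma measurable_weightedInterference (a : ℕ → ℝ) (n : ℕ) :
    Measurable (weightedInterference (N := N) a n) := by
  refine Measurable.tsum fun m => ?_
  refine Measurable.ite ?_ (by fun_prop) measurable_const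
  have m1 : Measurable fun y : ℕ → (Fin N × ℝ × ℕ) × ℝ => (y m).1.2.2 := by fun_prop
  exact (MeasurableSet.const _).inter (m1 (measurableSet_singleton 0)).compl

end Defect

namespace Network.Model

variable {N : ℕ} {Ω : Type*} [MeasurableSpace Ω] {P : Measure Ω}
    [IsProbabilityMeasure P] {p : Params N} {net : Network N Ω}
    (hp : p.Admissible) (hnet : net.Model P p)
include hp hnet

lemma measureReal_isTransmitter (n : ℕ) :
    P.real {ω | net.IsTransmitter n ω} = ∑ j, p.txProb j := by
  have h1 : {ω | net.IsTransmitter n ω} =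
      ⋃ j ∈ (univ : Finset (Fin N)), {ω | net.cached n ω = j ∧ net.IsTransmitter n ω} := by
    ext; simp
  rw [h1, measureReal_biUnion_finset]
  · exact sum_congr rfl fun j _ => hnet.measureReal_cached_isTransmitter hp n j
  · intro i _ j _ hij
    exact Set.disjoint_left.2 fun ω h h' => hij (h.1.symm.trans h'.1)
  · exact fun j _ => (hnet.measurableSet_cached n j).inter (hnet.measurableSet_isTransmitter n)

lemma txProb_nonneg (i : Fin N) : 0 ≤ p.txProb i :=
  hnet.measureReal_cached_isTransmitter hp 0 i ▸ measureReal_nonneg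

lemma txProb_le (i : Fin N) : p.txProb i ≤ p.pc i := by
  rw [← hnet.measureReal_cached_isTransmitter hp 0 i, ← hnet.measureReal_cached hp 0 i]
  exact measureReal_mono fun ω h => h.1

lemma txProb_le_sum (i : Fin N) : p.txProb i ≤ ∑ j, p.txProb j :=
  single_le_sum (fun j _ => hnet.txProb_nonneg hp j) (mem_univ i)

lemma defect_nonneg (i : Fin N) (near : Prop) {s : ℝ} (hs : 0 ≤ s) : 0 ≤ defect p i near s := by
  have h1 := hnet.txProb_le_sum hp i
  have h2 := hnet.txProb_nonneg hp i
  have h3 := hp.pc_nonneg i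
  refine add_nonneg (mul_nonneg (by linarith) (by positivity)) ?_
  split_ifs
  · exact h3
  · positivity

/-- The mean of the factor of one user, given its location, is `1 - defect`. -/
lemma lintegral_mark (n : ℕ) (i : Fin N) (near : Prop) [Decidable near]
    {s : ℝ} (hs : 0 ≤ s) :
    ∫⁻ ω, (if net.cached n ω = i ∧ near then 0 else 1) * expNeg (if net.demand n ω ≠ 0 then
      ENNReal.ofReal s * ENNReal.ofReal (net.gain n ω) else 0) ∂P =
      ENNReal.ofReal (1 - defect p i near s) := by
  classical
  have hc := hnet.measurableSet_cached n i
  have ht := hnet.measurableSet_isTransmitter n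
  let C : Set Ω := {ω | net.cached n ω = i ∧ near}
  let T : Set Ω := {ω | net.IsTransmitter n ω}
  have hC : MeasurableSet C := hc.inter (MeasurableSet.const _)
  have hCr : P.real C = if near then p.pc i else 0 := by
    by_cases h : near
    · simp only [C, h, and_true, if_true, hnet.measureReal_cached hp]
    · simp [C, h]
  have hCTr : P.real (C ∩ T) = if near then p.txProb i else 0 := by
    by_cases h : near
    · rw [if_pos h, ← hnet.measureReal_cached_isTransmitter hp n i]
      congr 1
      ext ω
      simp [C, T, h]
    · simp [C, h]
  have hTr : P.real T = ∑ j, p.txProb j := hnet.measureReal_isTransmitter hp n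
  have h1 : P.real (T \ C) = (∑ j, p.txProb j) - if near then p.txProb i else 0 := by
    have := measureReal_inter_add_sdiff (μ := P) (s := T) hC
    rw [Set.inter_comm, hCTr, hTr] at this
    linarith
  have h0 : P.real (C ∪ T)ᶜ = 1 - ((∑ j, p.txProb j) - (if near then p.txProb i else 0) +
      if near then p.pc i else 0) := by
    rw [probReal_compl_eq_one_sub (hC.union ht)]
    have := measureReal_union_add_inter (μ := P) (s := C) (t := T) ht
    rw [hCTr, hTr, hCr] at this
    linarith
  have hpt (ω : Ω) : (if net.cached n ω = i ∧ near then 0 else 1) *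
      expNeg (if net.demand n ω ≠ 0 then
        ENNReal.ofReal s * ENNReal.ofReal (net.gain n ω) else 0) =
      (C ∪ T)ᶜ.indicator 1 ω + (T \ C).indicator 1 ω *
        expNeg (ENNReal.ofReal s * ENNReal.ofReal (net.gain n ω)) := by
    by_cases hω : ω ∈ C <;> by_cases hω' : ω ∈ T
    · rw [if_pos (show net.cached n ω = i ∧ near from hω)]; simp [hω, hω']
    · rw [if_pos (show net.cached n ω = i ∧ near from hω)]; simp [hω, hω']
    · rw [if_neg (show ¬ (net.cached n ω = i ∧ near) from hω),
        if_pos (show net.demand n ω ≠ 0 from hω')]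
      simp [hω, hω']
    · rw [if_neg (show ¬ (net.cached n ω = i ∧ near) from hω),
        if_neg (show ¬ net.demand n ω ≠ 0 from hω')]
      simp [hω, hω']
  have hTC : Measurable ((T \ C).indicator (1 : Ω → ℝ≥0∞)) :=
    measurable_one.indicator (ht.diff hC)
  have hg : Measurable fun ω => expNeg (ENNReal.ofReal s * ENNReal.ofReal (net.gain n ω)) := by
    have := hnet.measurable_gain n
    fun_prop
  have hind : IndepFun ((T \ C).indicator (1 : Ω → ℝ≥0∞))
      (fun ω => expNeg (ENNReal.ofReal s * ENNReal.ofReal (net.gain n ω))) P := by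
    have hF : Measurable fun z : Fin N × ℝ × ℕ =>
        if z.2.2 ≠ 0 ∧ ¬ (z.1 = i ∧ near) then (1 : ℝ≥0∞) else 0 := by
      refine Measurable.ite ?_ measurable_const measurable_const
      have m1 : MeasurableSet {z : Fin N × ℝ × ℕ | z.2.2 = 0} :=
        measurable_snd.snd (measurableSet_singleton 0)
      have m2 : MeasurableSet {z : Fin N × ℝ × ℕ | z.1 = i} :=
        measurable_fst (measurableSet_singleton i)
      exact m1.compl.inter (m2.inter (MeasurableSet.const near)).compl
    have := (hnet.gain_indep n).comp hF
      (ψ := fun h => expNeg (ENNReal.ofReal s * ENNReal.ofReal h)) (by fun_prop)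
    have he : (T \ C).indicator (1 : Ω → ℝ≥0∞) = (fun z : Fin N × ℝ × ℕ =>
        if z.2.2 ≠ 0 ∧ ¬ (z.1 = i ∧ near) then (1 : ℝ≥0∞) else 0) ∘
          fun ω => (net.cached n ω, net.area n ω, net.demand n ω) := by
      ext ω
      by_cases hω : ω ∈ T \ C
      · rw [Set.indicator_of_mem hω]
        exact (if_pos hω).symm
      · rw [Set.indicator_of_notMem hω]
        exact (if_neg hω).symm
    rw [he]
    exact this
  have hgl : ∫⁻ ω, expNeg (ENNReal.ofReal s * ENNReal.ofReal (net.gain n ω)) ∂P =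
      ENNReal.ofReal (1 / (1 + s)) := by
    rw [← lintegral_expNeg_expMeasure hs, ← hnet.gain_law n,
      lintegral_map (by fun_prop) (hnet.measurable_gain n)]
  simp_rw [hpt]
  have hmul := lintegral_mul_eq_lintegral_mul_lintegral_of_indepFun hTC hg hind
  simp only [Pi.mul_apply] at hmul
  rw [lintegral_add_left (measurable_one.indicator (hC.union ht).compl), hmul,
    lintegral_indicator_one (hC.union ht).compl, lintegral_indicator_one (ht.diff hC), hgl,
    ← ofReal_measureReal, ← ofReal_measureReal, ← ENNReal.ofReal_mul measureReal_nonneg,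
    ← ENNReal.ofReal_add measureReal_nonneg (by positivity), h0, h1]
  congr 1
  rw [defect]
  split_ifs <;> field_simp <;> ring

lemma defect_le_one (i : Fin N) (near : Prop) {s : ℝ} (hs : 0 ≤ s) : defect p i near s ≤ 1 := by
  have h1 := hnet.txProb_le_sum hp i
  have h2 := hnet.txProb_nonneg hp i
  have h3 := hnet.txProb_le hp i
  have h4 : ∑ j, p.txProb j - p.txProb i ≤ 1 - p.pc i := by
    rw [← hp.pc_sum, ← sum_erase_eq_sub (mem_univ i), ← sum_erase_eq_sub (mem_univ i)]
    exact sum_le_sum fun j _ => hnet.txProb_le hp j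
  have h5 : s / (1 + s) ≤ 1 := (div_le_one (by positivity)).2 (by linarith)
  have h6 : 0 ≤ s / (1 + s) := by positivity
  have h7 := mul_le_of_le_one_right (sub_nonneg.2 h1) h5
  have h8 := mul_le_of_le_one_right h2 h5
  rw [defect]
  split_ifs <;> linarith

/-- Conditionally on the locations: the probability that user `n` caches file `i`, no nearer user
does, and its gain exceeds the noise `b` plus the interference. -/
lemma measure_served (n : ℕ) (i : Fin N) {near : ℕ → Prop} (hn : ¬ near n) {a : ℕ → ℝ}
    (ha : ∀ m, 0 ≤ a m) (b : ℝ≥0∞) :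
    P {ω | net.cached n ω = i ∧ (∀ m, net.cached m ω = i → ¬ near m) ∧
        b + weightedInterference a n (fun m => net.mark m ω) ≤ ENNReal.ofReal (net.gain n ω)} =
      ENNReal.ofReal (p.pc i) * expNeg b *
        iprod fun m => if m = n then 1 else 1 - ENNReal.ofReal (defect p i (near m) (a m)) := by
  classical
  have hwI := measurable_weightedInterference (N := N) a n
  have hM : Measurable fun ω m => net.mark m ω := measurable_pi_iff.2 hnet.measurable_mark
  let S : Set ((ℕ → (Fin N × ℝ × ℕ) × ℝ) × ((Fin N × ℝ × ℕ) × ℝ)) :=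
    {z | z.2.1.1 = i ∧ (∀ m, m ≠ n → ¬ ((z.1 m).1.1 = i ∧ near m)) ∧
      b + weightedInterference a n z.1 ≤ ENNReal.ofReal z.2.2}
  have hS : MeasurableSet S := by
    have m1 : Measurable fun z : (ℕ → (Fin N × ℝ × ℕ) × ℝ) × ((Fin N × ℝ × ℕ) × ℝ) => z.2.1.1 := by
      fun_prop
    have m2 (m : ℕ) : Measurable fun z : (ℕ → (Fin N × ℝ × ℕ) × ℝ) × ((Fin N × ℝ × ℕ) × ℝ) =>
      (z.1 m).1.1 := by fun_prop
    have m3 : MeasurableSet {z : (ℕ → (Fin N × ℝ × ℕ) × ℝ) × ((Fin N × ℝ × ℕ) × ℝ) |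
        ∀ m, m ≠ n → ¬ ((z.1 m).1.1 = i ∧ near m)} := by
      simp only [Set.ofPred_forall]
      refine .iInter fun m => .iInter fun _ => ?_
      exact ((m2 m (measurableSet_singleton i)).inter (MeasurableSet.const (near m))).compl
    exact (m1 (measurableSet_singleton i)).inter (m3.inter
      (measurableSet_le (measurable_const.add (hwI.comp measurable_fst)) (by fun_prop)))
  have hsplit := lintegral_of_iIndepFun hnet.measurable_mark hnet.marks_indep n
    (f := S.indicator 1) (measurable_one.indicator hS) (fun y z z' => by
      have h1 : weightedInterference a n (Function.update y n z') = weightedInterference a n y := by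
        refine tsum_congr fun m => ?_
        by_cases h : m = n
        · simp [h]
        · rw [Function.update_of_ne h]
      have h2 : (Function.update y n z', z) ∈ S ↔ (y, z) ∈ S := by
        simp only [S, Set.mem_ofPred_eq, h1]
        refine and_congr_right fun _ => and_congr_left fun _ => forall_congr' fun m =>
          forall_congr' fun h => ?_
        rw [Function.update_of_ne h]
      by_cases h : (y, z) ∈ S
      · rw [Set.indicator_of_mem h, Set.indicator_of_mem (h2.2 h)]; rfl
      · rw [Set.indicator_of_notMem h, Set.indicator_of_notMem (fun h' => h (h2.1 h'))])
  have hlhs : P {ω | net.cached n ω = i ∧ (∀ m, net.cached m ω = i → ¬ near m) ∧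
        b + weightedInterference a n (fun m => net.mark m ω) ≤ ENNReal.ofReal (net.gain n ω)} =
      ∫⁻ ω, S.indicator 1 (fun m => net.mark m ω, net.mark n ω) ∂P := by
    have hpre := (hM.prodMk (hnet.measurable_mark n)) hS
    rw [show (fun ω => S.indicator 1 (fun m => net.mark m ω, net.mark n ω)) =
      ((fun ω => ((fun m => net.mark m ω), net.mark n ω)) ⁻¹' S).indicator (1 : Ω → ℝ≥0∞) from rfl,
      lintegral_indicator_one hpre]
    congr 1
    ext ω
    refine and_congr_right fun _ => and_congr_left fun _ => forall_congr' fun m => ?_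
    constructor
    · exact fun h _ h' => h h'.1 h'.2
    · intro h hc hnr
      exact h (fun e => hn (e ▸ hnr)) ⟨hc, hnr⟩
  -- integrate the marks of user `n`
  have hinner (ω : Ω) : ∫⁻ ω', S.indicator 1 (fun m => net.mark m ω, net.mark n ω') ∂P =
      ENNReal.ofReal (p.pc i) * expNeg b * iprod fun m => if m = n then 1 else
        (if net.cached m ω = i ∧ near m then 0 else 1) * expNeg (if net.demand m ω ≠ 0 then
          ENNReal.ofReal (a m) * ENNReal.ofReal (net.gain m ω) else 0) := by
    set B := b + weightedInterference a n (fun m => net.mark m ω) with hB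
    have hprob : P {ω' | net.cached n ω' = i ∧ B ≤ ENNReal.ofReal (net.gain n ω')} =
        ENNReal.ofReal (p.pc i) * expNeg B := by
      have m1 : MeasurableSet {h : ℝ | B ≤ ENNReal.ofReal h} :=
        measurableSet_le measurable_const (by fun_prop)
      have m2 : MeasurableSet {z : Fin N × ℝ × ℕ | z.1 = i} :=
        measurable_fst (measurableSet_singleton i)
      have h := (hnet.gain_indep n).measure_inter_preimage_eq_mul _ _ m2 m1
      rw [← Measure.map_apply (hnet.measurable_gain n) m1, hnet.gain_law, expMeasure_le_ofReal] at h
      rw [← hnet.measure_cached hp n i]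
      exact h
    have hstep : ∫⁻ ω', S.indicator 1 (fun m => net.mark m ω, net.mark n ω') ∂P =
        (if ∀ m, m = n ∨ ¬ (net.cached m ω = i ∧ near m) then 1 else 0) *
          P {ω' | net.cached n ω' = i ∧ B ≤ ENNReal.ofReal (net.gain n ω')} := by
      have hpre : MeasurableSet ((fun ω' => ((fun m => net.mark m ω), net.mark n ω')) ⁻¹' S) :=
        (measurable_const.prodMk (hnet.measurable_mark n)) hS
      rw [show (fun ω' => S.indicator 1 (fun m => net.mark m ω, net.mark n ω')) =
        ((fun ω' => ((fun m => net.mark m ω), net.mark n ω')) ⁻¹' S).indicator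
          (1 : Ω → ℝ≥0∞) from rfl,
        lintegral_indicator_one hpre]
      split_ifs with h
      · rw [one_mul]
        congr 1
        ext ω'
        exact ⟨fun h' => ⟨h'.1, h'.2.2⟩, fun h' => ⟨h'.1, fun m hm => (h m).resolve_left hm, h'.2⟩⟩
      · rw [zero_mul]
        convert measure_empty (μ := P)
        ext ω'
        simp only [Set.mem_empty_iff_false, iff_false]
        exact fun h' => h fun m => or_iff_not_imp_left.2 (h'.2.1 m)
    rw [hstep, hprob, hB, expNeg_add, weightedInterference, ← iprod_expNeg, ← iprod_indicator,
      mul_comm, mul_assoc, mul_assoc, mul_assoc, ← iprod_mul (fun _ => expNeg_le_one _)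
        (fun m => by split_ifs <;> simp)]
    congr 3
    ext m
    by_cases hm : m = n
    · simp [hm]
    · simp only [hm, ne_eq, not_false_eq_true, true_and, if_false, false_or, ite_not]
      rw [mul_comm]
      rfl
  -- integrate the marks of the other users
  have hg (m : ℕ) : Measurable fun z : (Fin N × ℝ × ℕ) × ℝ => if m = n then (1 : ℝ≥0∞) else
      (if z.1.1 = i ∧ near m then 0 else 1) * expNeg (if z.1.2.2 ≠ 0 then
        ENNReal.ofReal (a m) * ENNReal.ofReal z.2 else 0) := by
    have m1 : Measurable fun z : (Fin N × ℝ × ℕ) × ℝ => z.1.1 := by fun_prop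
    have m2 : Measurable fun z : (Fin N × ℝ × ℕ) × ℝ => z.1.2.2 := by fun_prop
    refine Measurable.ite (MeasurableSet.const _) measurable_const (Measurable.mul ?_ ?_)
    · exact Measurable.ite ((m1 (measurableSet_singleton i)).inter (MeasurableSet.const _))
        measurable_const measurable_const
    · exact measurable_expNeg.comp (Measurable.ite (m2 (measurableSet_singleton 0)).compl
        (by fun_prop) measurable_const)
  have hind := hnet.marks_indep.comp _ hg
  rw [hlhs, hsplit]
  simp_rw [hinner]
  have hm1 (m : ℕ) := (hg m).comp (hnet.measurable_mark m)
  rw [lintegral_const_mul]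
  · congr 1
    refine (lintegral_iprod_of_iIndepFun hm1 (fun m ω => ?_) hind).trans ?_
    · dsimp only [Function.comp]
      split_ifs <;> simp [expNeg_le_one]
    · congr 1
      ext m
      by_cases hm : m = n
      · simp [hm]
      · simp only [hm, if_false, Function.comp]
        rw [← ENNReal.ofReal_one, ← ENNReal.ofReal_sub _ (hnet.defect_nonneg hp i _ (ha m)),
          ← hnet.lintegral_mark hp m i (near m) (ha m), ENNReal.ofReal_one]
        rfl
  · exact measurable_iprod fun m => hm1 m

end Network.Model

/-! ### The energy constraint -/

lemma Params.Admissible.Gamma1_pos {N : ℕ} {p : Params N} (hp : p.Admissible) : 0 < p.Gamma1 := by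
  have h1 := hp.F_pos
  have h2 := hp.Pt_pos
  have h3 := hp.Pc_nonneg
  have h4 := hp.eta_pos
  have h5 := hp.W_pos
  have h6 := hp.rho_pos
  have h7 := hp.Q_pos
  have h8 := hp.V0_pos
  have h9 : 0 < Real.log 2 := Real.log_pos one_lt_two
  rw [Params.Gamma1, sub_pos, Real.one_lt_exp_iff]
  positivity

namespace Network

variable {N : ℕ} {Ω : Type*} {p : Params N} {net : Network N Ω}
    (hp : p.Admissible)

include hp

lemma received_eq (m : ℕ) {ω : Ω} (hx : net.pos m ω ≠ 0) :
    net.received p m ω = ENNReal.ofReal (p.Pt * ‖net.pos m ω‖ ^ (-p.alpha)) *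
      ENNReal.ofReal (net.gain m ω) := by
  have h : 0 < ‖net.pos m ω‖ := norm_pos_iff.2 hx
  rw [received, ENNReal.ofReal_mul hp.Pt_pos.le, ENNReal.ofReal_mul hp.Pt_pos.le,
    ← ENNReal.ofReal_rpow_of_pos h, ofReal_norm]
  ring

lemma sinr_ne_top (n : ℕ) {ω : Ω} (hx : net.pos n ω ≠ 0) : net.sinr p n ω ≠ ∞ := by
  refine ENNReal.div_ne_top ?_ ?_
  · rw [received_eq hp n hx]
    exact ENNReal.mul_ne_top ENNReal.ofReal_ne_top ENNReal.ofReal_ne_top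
  · exact (lt_of_lt_of_le (ENNReal.ofReal_pos.2 hp.sigmaSq_pos) le_add_self).ne'

/-- The energy constraint is the constraint `Γ₁ ≤ γ` on the SINR. -/
lemma energy_le_iff_sinr (n : ℕ) {ω : Ω} (hx : net.pos n ω ≠ 0) :
    net.energy p n ω ≤ ENNReal.ofReal (p.rho * p.Q * p.V0) ↔
      ENNReal.ofReal p.Gamma1 ≤ net.sinr p n ω := by
  have h1 := hp.F_pos
  have h2 := hp.Pt_pos
  have h3 := hp.Pc_nonneg
  have h4 := hp.eta_pos
  have h5 := hp.W_pos
  have h6 := hp.rho_pos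
  have h7 := hp.Q_pos
  have h8 := hp.V0_pos
  have h9 : 0 < Real.log 2 := Real.log_pos one_lt_two
  set g := (net.sinr p n ω).toReal with hg
  have hg0 : 0 ≤ g := ENNReal.toReal_nonneg
  have hr0 : 0 ≤ net.rate p n ω := mul_nonneg h5.le (Real.logb_nonneg one_lt_two (by linarith))
  have hE : 0 < p.rho * p.Q * p.V0 := by positivity
  have hc : 0 < 1 / p.eta * p.Pt + p.Pc := by positivity
  have step1 : net.energy p n ω ≤ ENNReal.ofReal (p.rho * p.Q * p.V0) ↔
      p.F * (1 / p.eta * p.Pt + p.Pc) ≤ p.rho * p.Q * p.V0 * net.rate p n ω := by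
    rw [energy]
    rcases hr0.eq_or_lt with h | h
    · rw [← h, ENNReal.ofReal_zero, ENNReal.div_zero (ENNReal.ofReal_pos.2 h1).ne',
        ENNReal.top_mul (ENNReal.ofReal_pos.2 hc).ne', mul_zero]
      simp only [top_le_iff, ENNReal.ofReal_ne_top, false_iff, not_le]
      positivity
    · rw [← ENNReal.ofReal_div_of_pos h, ← ENNReal.ofReal_mul (by positivity),
        ENNReal.ofReal_le_ofReal_iff hE.le, div_mul_eq_mul_div, div_le_iff₀ h]
  rw [step1, ENNReal.ofReal_le_iff_le_toReal (sinr_ne_top hp n hx), ← hg, Params.Gamma1,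
    sub_le_iff_le_add, add_comm g, ← Real.le_log_iff_exp_le (by positivity), rate, Real.logb, ← hg,
    div_le_iff₀ (by positivity)]
  rw [show p.rho * p.Q * p.V0 * (p.W * (Real.log (1 + g) / Real.log 2)) =
    Real.log (1 + g) * (p.W * p.rho * p.Q * p.V0) / Real.log 2 by ring, le_div_iff₀ h9,
    show p.F * (1 / p.eta * p.Pt + p.Pc) * Real.log 2 =
      p.F * (p.Pt + p.eta * p.Pc) * Real.log 2 / p.eta by field_simp, div_le_iff₀ h4]
  ring_nf

/-- The energy constraint, solved for the channel gain of the serving user. -/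
lemma energy_le_iff_gain (n : ℕ) {ω : Ω} (hx : ∀ m, net.pos m ω ≠ 0) :
    net.energy p n ω ≤ ENNReal.ofReal (p.rho * p.Q * p.V0) ↔
      ENNReal.ofReal (p.Gamma1 * ‖net.pos n ω‖ ^ p.alpha * (p.sigmaSq / p.Pt)) +
        weightedInterference (fun m => p.Gamma1 * (‖net.pos n ω‖ / ‖net.pos m ω‖) ^ p.alpha) n
          (fun m => net.mark m ω) ≤ ENNReal.ofReal (net.gain n ω) := by
  have hG := hp.Gamma1_pos
  have h2 := hp.Pt_pos
  have hs := hp.sigmaSq_pos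
  have hpos (m : ℕ) : 0 < ‖net.pos m ω‖ := norm_pos_iff.2 (hx m)
  have hr := hpos n
  set κ := p.Pt * ‖net.pos n ω‖ ^ (-p.alpha) with hκ
  have hκ0 : 0 < κ := by positivity
  have hκr : ‖net.pos n ω‖ ^ (-p.alpha) * ‖net.pos n ω‖ ^ p.alpha = 1 := by
    rw [← Real.rpow_add hr]; simp
  have hden : net.interference p n ω + ENNReal.ofReal p.sigmaSq ≠ 0 :=
    (lt_of_lt_of_le (ENNReal.ofReal_pos.2 hs) le_add_self).ne'
  have hrec : net.received p n ω ≠ ∞ := by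
    rw [received_eq hp n (hx n)]
    exact ENNReal.mul_ne_top ENNReal.ofReal_ne_top ENNReal.ofReal_ne_top
  have hI : ENNReal.ofReal p.Gamma1 * net.interference p n ω = ENNReal.ofReal κ *
      weightedInterference (fun m => p.Gamma1 * (‖net.pos n ω‖ / ‖net.pos m ω‖) ^ p.alpha) n
          (fun m => net.mark m ω) := by
    rw [interference, weightedInterference, ← ENNReal.tsum_mul_left, ← ENNReal.tsum_mul_left]
    refine tsum_congr fun m => ?_
    by_cases hm : m ≠ n ∧ net.IsTransmitter m ω
    · rw [if_pos hm, if_pos (show m ≠ n ∧ (net.mark m ω).1.2.2 ≠ 0 from hm),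
        received_eq hp m (hx m), ← mul_assoc, ← mul_assoc, ← ENNReal.ofReal_mul hG.le,
        ← ENNReal.ofReal_mul hκ0.le]
      congr 2
      rw [hκ, Real.div_rpow hr.le (hpos m).le, Real.rpow_neg (hpos m).le]
      have : ‖net.pos m ω‖ ^ p.alpha ≠ 0 := (Real.rpow_pos_of_pos (hpos m) _).ne'
      field_simp
      linear_combination -hκr
    · rw [if_neg hm, if_neg (show ¬ (m ≠ n ∧ (net.mark m ω).1.2.2 ≠ 0) from hm), mul_zero, mul_zero]
  have : κ * (p.Gamma1 * ‖net.pos n ω‖ ^ p.alpha * (p.sigmaSq / p.Pt)) = p.Gamma1 * p.sigmaSq := by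
    rw [hκ]
    field_simp
    linear_combination hκr
  rw [energy_le_iff_sinr hp n (hx n), sinr, ENNReal.le_div_iff_mul_le (Or.inl hden) (Or.inr hrec),
    mul_add, hI, received_eq hp n (hx n), ← hκ, ← ENNReal.ofReal_mul hG.le, ← this,
    ENNReal.ofReal_mul hκ0.le, add_comm, ← mul_add]
  exact ENNReal.mul_le_mul_iff_right (ENNReal.ofReal_pos.2 hκ0).ne' ENNReal.ofReal_ne_top

end Network

/-! ### The serving user -/

/-- The defect of a user at `y` when the serving user is at distance `r`. -/
noncomputable def pointDefect {N : ℕ} (p : Params N) (i : Fin N) (r : ℝ) (y : Plane) : ℝ :=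
  defect p i (‖y‖ < r) (p.Gamma1 * (r / ‖y‖) ^ p.alpha)

/-- The locations and marks for which user `n` serves a request of file `i` within the energy
constraint, the latter in the form of `Network.energy_le_iff_gain`. -/
def servedSet {N : ℕ} (p : Params N) (i : Fin N) (n : ℕ) :
    Set ((ℕ → Plane) × (ℕ → (Fin N × ℝ × ℕ) × ℝ)) :=
  {z | ((z.2 n).1.1 = i ∧ (∀ m, (z.2 m).1.1 = i → ¬ ‖z.1 m‖ < ‖z.1 n‖) ∧
    ENNReal.ofReal (p.Gamma1 * ‖z.1 n‖ ^ p.alpha * (p.sigmaSq / p.Pt)) +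
      weightedInterference (fun m => p.Gamma1 * (‖z.1 n‖ / ‖z.1 m‖) ^ p.alpha) n z.2 ≤
        ENNReal.ofReal (z.2 n).2) ∧ ‖z.1 n‖ < p.rc}

section

variable {N : ℕ} (p : Params N) (i : Fin N)

lemma measurableSet_servedSet (n : ℕ) : MeasurableSet (servedSet p i n) := by
  have m1 (m : ℕ) : Measurable fun z : (ℕ → Plane) × (ℕ → (Fin N × ℝ × ℕ) × ℝ) =>
    (z.2 m).1.1 := by fun_prop
  have m2 (m : ℕ) : Measurable fun z : (ℕ → Plane) × (ℕ → (Fin N × ℝ × ℕ) × ℝ) => ‖z.1 m‖ := by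
    fun_prop
  have m3 (m : ℕ) : Measurable fun z : (ℕ → Plane) × (ℕ → (Fin N × ℝ × ℕ) × ℝ) =>
    (z.2 m).1.2.2 := by fun_prop
  have m4 : MeasurableSet {z : (ℕ → Plane) × (ℕ → (Fin N × ℝ × ℕ) × ℝ) |
      ∀ m, (z.2 m).1.1 = i → ¬ ‖z.1 m‖ < ‖z.1 n‖} := by
    have : {z : (ℕ → Plane) × (ℕ → (Fin N × ℝ × ℕ) × ℝ) |
      ∀ m, (z.2 m).1.1 = i → ¬ ‖z.1 m‖ < ‖z.1 n‖} =
      ⋂ m, ({z | (z.2 m).1.1 = i} ∩ {z | ‖z.1 m‖ < ‖z.1 n‖})ᶜ := by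
      ext; simp
    rw [this]
    exact .iInter fun m => ((m1 m (measurableSet_singleton i)).inter
      (measurableSet_lt (m2 m) (m2 n))).compl
  have m5 : Measurable fun z : (ℕ → Plane) × (ℕ → (Fin N × ℝ × ℕ) × ℝ) =>
      weightedInterference (fun m => p.Gamma1 * (‖z.1 n‖ / ‖z.1 m‖) ^ p.alpha) n z.2 := by
    refine Measurable.tsum fun m => ?_
    refine Measurable.ite ?_ (by fun_prop) measurable_const
    exact (MeasurableSet.const _).inter (m3 m (measurableSet_singleton 0)).compl
  refine MeasurableSet.inter ((m1 n (measurableSet_singleton i)).inter (m4.inter ?_))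
    (measurableSet_lt (m2 n) measurable_const)
  exact measurableSet_le (Measurable.add (by fun_prop) m5) (by fun_prop)

lemma measurable_pointDefect (r : ℝ) : Measurable (pointDefect p i r) := by
  have h : Measurable fun y : Plane => p.Gamma1 * (r / ‖y‖) ^ p.alpha := by fun_prop
  refine Measurable.add (by fun_prop) (Measurable.ite ?_ measurable_const (by fun_prop))
  exact measurableSet_lt measurable_norm measurable_const

variable {p}

lemma fade_nonneg (hp : p.Admissible) {r t : ℝ} (hr : 0 ≤ r) (ht : 0 ≤ t) :
    0 ≤ p.Gamma1 * (r / t) ^ p.alpha :=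
  mul_nonneg hp.Gamma1_pos.le (Real.rpow_nonneg (div_nonneg hr ht) _)

lemma continuousWithinAt_pointDefect (hp : p.Admissible) (y : Plane) {r : ℝ} (hr : 0 ≤ r) :
    ContinuousWithinAt (fun s => pointDefect p i s y) (Set.Icc 0 r) r := by
  have hα : 0 ≤ p.alpha := by linarith [hp.two_lt_alpha]
  have h1 : ContinuousAt (fun s => p.Gamma1 * (s / ‖y‖) ^ p.alpha) r :=
    (((Real.continuous_rpow_const hα).comp (continuous_id.div_const _)).const_mul _).continuousAt
  have h2 : ContinuousAt (fun s => p.Gamma1 * (s / ‖y‖) ^ p.alpha /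
      (1 + p.Gamma1 * (s / ‖y‖) ^ p.alpha)) r := by
    refine h1.div (continuousAt_const.add h1) ?_
    have := fade_nonneg hp hr (norm_nonneg y)
    positivity
  refine ContinuousWithinAt.add (h2.const_mul _).continuousWithinAt ?_
  rcases lt_or_ge ‖y‖ r with h | h
  · have h3 : ContinuousAt (fun s => if ‖y‖ < s then p.pc i else p.txProb i *
        (p.Gamma1 * (s / ‖y‖) ^ p.alpha / (1 + p.Gamma1 * (s / ‖y‖) ^ p.alpha))) r := by
      refine (continuousAt_const (y := p.pc i)).congr ?_
      filter_upwards [lt_mem_nhds h] with s hs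
      rw [if_pos hs]
    convert h3.continuousWithinAt (s := Set.Icc 0 r)
  · refine (h2.const_mul (p.txProb i)).continuousWithinAt.congr (fun s hs => ?_) ?_
    · rw [if_neg (not_lt.2 (hs.2.trans h))]
    · rw [if_neg (not_lt.2 h)]

end

namespace Network.Model

variable {N : ℕ} {Ω : Type*} [MeasurableSpace Ω] {P : Measure Ω}
    [IsProbabilityMeasure P] {p : Params N} {net : Network N Ω}
    (hp : p.Admissible) (hnet : net.Model P p)
include hp hnet

/-- The fading weight increases with the distance of the serving user. When that distance exceeds
`‖y‖`, the term `txProb i * (s / (1 + s))` of the defect jumps to `pc i`, which is larger. -/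
lemma monotoneOn_pointDefect (i : Fin N) (y : Plane) :
    MonotoneOn (fun r => pointDefect p i r y) (Set.Ici 0) := by
  intro r hr s hs hrs
  have hα : 0 ≤ p.alpha := by linarith [hp.two_lt_alpha]
  have h1 : p.Gamma1 * (r / ‖y‖) ^ p.alpha ≤ p.Gamma1 * (s / ‖y‖) ^ p.alpha := by
    refine mul_le_mul_of_nonneg_left ?_ hp.Gamma1_pos.le
    exact Real.rpow_le_rpow (div_nonneg hr (norm_nonneg y))
      (div_le_div_of_nonneg_right hrs (norm_nonneg y)) hα
  have h0 := fade_nonneg hp hr (norm_nonneg y)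
  have h0' := fade_nonneg hp hs (norm_nonneg y)
  dsimp only [pointDefect, defect]
  set a := p.Gamma1 * (r / ‖y‖) ^ p.alpha
  set b := p.Gamma1 * (s / ‖y‖) ^ p.alpha
  have h2 : a / (1 + a) ≤ b / (1 + b) := by
    rw [div_le_div_iff₀ (by positivity) (by positivity)]
    linarith
  have h3 : b / (1 + b) ≤ 1 := (div_le_one (by positivity)).2 (by linarith)
  have h4 := hnet.txProb_nonneg hp i
  have h5 := hnet.txProb_le hp i
  refine add_le_add (mul_le_mul_of_nonneg_left h2 (sub_nonneg.2 (hnet.txProb_le_sum hp i))) ?_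
  split_ifs with h6 h7 h7
  · exact le_rfl
  · exact absurd (h6.trans_le hrs) h7
  · exact (mul_le_of_le_one_right h4 (h2.trans h3)).trans h5
  · exact mul_le_mul_of_nonneg_left h2 h4

lemma measure_servedSet (i : Fin N) (n : ℕ) :
    P {ω | ((fun m => net.pos m ω), (fun m => net.mark m ω)) ∈ servedSet p i n} =
      ∫⁻ ω, ((Metric.ball (0 : Plane) p.rc).indicator (fun x => ENNReal.ofReal (p.pc i) *
        expNeg (ENNReal.ofReal (p.Gamma1 * ‖x‖ ^ p.alpha * (p.sigmaSq / p.Pt)))) (net.pos n ω)) *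
          prodOthers (fun y => ENNReal.ofReal (pointDefect p i ‖net.pos n ω‖ y))
            net.pos n ω ∂P := by
  have hX : Measurable fun ω m => net.pos m ω := measurable_pi_iff.2 hnet.users.measurable
  have hM : Measurable fun ω m => net.mark m ω := measurable_pi_iff.2 hnet.measurable_mark
  have hS := measurableSet_servedSet p i n
  have h1 := lintegral_of_indepFun hX hM hnet.pos_marks_indep
    (f := (servedSet p i n).indicator 1) (measurable_one.indicator hS)
  have h2 (ω : Ω) : ∫⁻ ω', (servedSet p i n).indicator 1
      ((fun m => net.pos m ω), (fun m => net.mark m ω')) ∂P =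
      P {ω' | ((fun m => net.pos m ω), (fun m => net.mark m ω')) ∈ servedSet p i n} := by
    have hpre := (measurable_const (a := fun m => net.pos m ω).prodMk hM) hS
    exact (lintegral_indicator_one hpre)
  have h3 : ∫⁻ ω, (servedSet p i n).indicator 1
      ((fun m => net.pos m ω), (fun m => net.mark m ω)) ∂P =
      P {ω | ((fun m => net.pos m ω), (fun m => net.mark m ω)) ∈ servedSet p i n} :=
    lintegral_indicator_one ((hX.prodMk hM) hS)
  rw [← h3, h1]
  refine lintegral_congr fun ω => ?_
  rw [h2]
  by_cases hrc : ‖net.pos n ω‖ < p.rc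
  · rw [Set.indicator_of_mem (by simpa using hrc)]
    have h4 := hnet.measure_served hp n i (near := fun m => ‖net.pos m ω‖ < ‖net.pos n ω‖)
      (lt_irrefl _) (a := fun m => p.Gamma1 * (‖net.pos n ω‖ / ‖net.pos m ω‖) ^ p.alpha)
      (fun m => fade_nonneg hp (norm_nonneg _) (norm_nonneg _))
      (ENNReal.ofReal (p.Gamma1 * ‖net.pos n ω‖ ^ p.alpha * (p.sigmaSq / p.Pt)))
    refine Eq.trans ?_ h4
    congr 1
    ext ω'
    exact and_iff_left hrc
  · rw [Set.indicator_of_notMem (by simpa using hrc), zero_mul]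
    convert measure_empty (μ := P)
    ext ω'
    simp only [Set.mem_empty_iff_false, iff_false]
    exact fun h => hrc h.2

/-- The probability that the nearest user caching file `i` is within the collaboration distance
and satisfies the energy constraint. -/
lemma measure_exists_servedSet (i : Fin N) :
    P {ω | ∃ n, ((fun m => net.pos m ω), (fun m => net.mark m ω)) ∈ servedSet p i n} =
      ∫⁻ x, (Metric.ball (0 : Plane) p.rc).indicator (fun x => ENNReal.ofReal (p.pc i) *
        expNeg (ENNReal.ofReal (p.Gamma1 * ‖x‖ ^ p.alpha * (p.sigmaSq / p.Pt)))) x *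
          expNeg (∫⁻ y, ENNReal.ofReal (pointDefect p i ‖x‖ y)
            ∂(ENNReal.ofReal p.lam • (volume : Measure Plane)))
          ∂(ENNReal.ofReal p.lam • (volume : Measure Plane)) := by
  have hX : Measurable fun ω m => net.pos m ω := measurable_pi_iff.2 hnet.users.measurable
  have hM : Measurable fun ω m => net.mark m ω := measurable_pi_iff.2 hnet.measurable_mark
  have hball : MeasurableSet (Metric.ball (0 : Plane) p.rc) := measurableSet_ball
  rw [← hnet.users.mecke_monotone (u := fun r y => ENNReal.ofReal (pointDefect p i r y))
    (R := fun x => ‖x‖)]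
  · simp_rw [← hnet.measure_servedSet hp i]
    rw [← measure_iUnion₀]
    · congr 1
      ext ω
      simp
    · intro a b hab
      refine measure_mono_null (t := {ω | ¬ ∀ n m, m ≠ n → ‖net.pos m ω‖ ≠ ‖net.pos n ω‖}) ?_
        (ae_iff.1 hnet.users.ae_norm_injective)
      rintro ω ⟨ha, hb⟩ hω
      refine hω a b hab.symm (le_antisymm ?_ ?_)
      · exact not_lt.1 (hb.1.2.1 a ha.1.1)
      · exact not_lt.1 (ha.1.2.1 b hb.1.1)
    · exact fun n => ((hX.prodMk hM) (measurableSet_servedSet p i n)).nullMeasurableSet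
  · exact Measurable.indicator (by fun_prop) hball
  · intro x
    refine ne_top_of_le_ne_top ?_ (Set.indicator_le_self' (fun _ _ => zero_le) x)
    exact ENNReal.mul_ne_top ENNReal.ofReal_ne_top (expNeg_ne_top _)
  · have hpc : p.pc i ≤ 1 := by
      rw [← hnet.measureReal_cached hp 0 i]
      exact measureReal_le_one
    refine ne_top_of_le_ne_top (b := ∫⁻ x, (Metric.ball (0 : Plane) p.rc).indicator (fun _ => 1) x
      ∂(ENNReal.ofReal p.lam • (volume : Measure Plane))) ?_ (lintegral_mono fun x => ?_)
    · rw [lintegral_indicator_const hball, one_mul, Measure.smul_apply, smul_eq_mul]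
      exact ENNReal.mul_ne_top ENNReal.ofReal_ne_top measure_ball_lt_top.ne
    · exact Set.indicator_le_indicator
        (mul_le_one' (ENNReal.ofReal_le_one.2 hpc) (expNeg_le_one _))
  · exact fun r => (measurable_pointDefect p i r).ennreal_ofReal
  · exact fun r hr y => ENNReal.ofReal_le_one.2
      (hnet.defect_le_one hp i _ (fade_nonneg hp hr (norm_nonneg y)))
  · exact fun x a ha b hb hab => ENNReal.ofReal_le_ofReal
      (hnet.monotoneOn_pointDefect hp i x ha hb hab)
  · exact fun x r hr => (ENNReal.continuous_ofReal.continuousAt.comp_continuousWithinAt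
      (continuousWithinAt_pointDefect i hp x hr))
  · exact measurable_norm
  · exact norm_nonneg

/-- The request of the typical user is independent of the other variables. -/
lemma measure_offloading :
    P {ω | ∃ n, net.IsNearestHelper (net.request ω) n ω ∧ ‖net.pos n ω‖ < p.rc ∧
      net.energy p n ω ≤ ENNReal.ofReal (p.rho * p.Q * p.V0)} =
    ∑ i, ENNReal.ofReal (p.popularity i) *
      P {ω | ∃ n, ((fun m => net.pos m ω), (fun m => net.mark m ω)) ∈ servedSet p i n} := by
  have hX : Measurable fun ω m => net.pos m ω := measurable_pi_iff.2 hnet.users.measurable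
  have hM : Measurable fun ω m => net.mark m ω := measurable_pi_iff.2 hnet.measurable_mark
  let A : Fin N → Set ((ℕ → Plane) × (ℕ → (Fin N × ℝ × ℕ) × ℝ)) := fun i => ⋃ n, servedSet p i n
  have hA (i) : MeasurableSet (A i) := .iUnion fun n => measurableSet_servedSet p i n
  have hXM : Measurable fun ω => ((fun m => net.pos m ω), (fun m => net.mark m ω)) := hX.prodMk hM
  have hae : ∀ᵐ ω ∂P, ∀ i n, (((fun m => net.pos m ω), (fun m => net.mark m ω)) ∈
      servedSet p i n ↔ net.IsNearestHelper i n ω ∧ ‖net.pos n ω‖ < p.rc ∧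
        net.energy p n ω ≤ ENNReal.ofReal (p.rho * p.Q * p.V0)) := by
    filter_upwards [hnet.users.ae_ne_zero] with ω hω i n
    rw [Network.energy_le_iff_gain hp n hω]
    simp only [servedSet, Set.mem_ofPred_eq, not_lt, IsNearestHelper]
    exact ⟨fun h => ⟨⟨h.1.1, h.1.2.1⟩, h.2, h.1.2.2⟩, fun h => ⟨⟨h.1.1, h.1.2, h.2.2⟩, h.2.1⟩⟩
  have h1 : {ω | ∃ n, net.IsNearestHelper (net.request ω) n ω ∧ ‖net.pos n ω‖ < p.rc ∧
      net.energy p n ω ≤ ENNReal.ofReal (p.rho * p.Q * p.V0)} =ᵐ[P]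
      ⋃ i ∈ (univ : Finset (Fin N)), net.request ⁻¹' {i} ∩
        (fun ω => ((fun m => net.pos m ω), (fun m => net.mark m ω))) ⁻¹' A i := by
    refine eventuallyEq_set.2 ?_
    filter_upwards [hae] with ω hω
    simp only [← hω, A]
    simp
  rw [measure_congr h1, measure_biUnion_finset]
  · refine sum_congr rfl fun i _ => ?_
    rw [hnet.request_indep.measure_inter_preimage_eq_mul _ _ (measurableSet_singleton i) (hA i)]
    congr 1
    · exact hnet.request_law i
    · congr 1
      ext ω
      simp [A]
  · intro i _ j _ hij
    exact Set.disjoint_left.2 fun ω h h' => hij (h.1.symm.trans h'.1)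
  · exact fun i _ => (hnet.measurable_request (measurableSet_singleton i)).inter (hXM (hA i))

end Network.Model

/-! ### Radial integrals -/

lemma integral_norm_sq (H : ℝ → ℝ) :
    ∫ y : Plane, H (‖y‖ ^ 2) = Real.pi * ∫ t in Set.Ioi (0 : ℝ), H t := by
  have hb : volume.real (Metric.ball (0 : Plane) 1) = Real.pi := by
    rw [measureReal_def, volume_ball_plane 1 zero_le_one, ENNReal.toReal_ofReal (by positivity)]
    ring
  rw [integral_fun_norm_addHaar volume (fun r => H (r ^ 2)), hb,
    ← integral_comp_rpow_Ioi_of_pos (g := H) two_pos]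
  simp only [finrank_euclideanSpace, Fintype.card_fin, nsmul_eq_mul, smul_eq_mul]
  rw [mul_left_comm, ← integral_const_mul]
  congr 2
  ext t
  norm_num
  ring

lemma integrable_norm_sq {H : ℝ → ℝ} (hH : IntegrableOn H (Set.Ioi 0)) :
    Integrable fun y : Plane => H (‖y‖ ^ 2) := by
  rw [integrable_fun_norm_addHaar volume (f := fun r => H (r ^ 2))]
  have := (integrableOn_Ioi_comp_rpow_iff' H two_ne_zero).2 hH
  norm_num at this
  simpa using this

lemma integrableOn_fade {a : ℝ} (ha : 1 < a) :
    IntegrableOn (fun t : ℝ => 1 / (1 + t ^ a)) (Set.Ioi 0) := by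
  have hm : Measurable fun t : ℝ => 1 / (1 + t ^ a) := by fun_prop
  rw [← Set.Ioc_union_Ioi_eq_Ioi zero_le_one, integrableOn_union]
  constructor
  · refine Integrable.mono' (g := fun _ => 1) (integrableOn_const (by simp))
      hm.aestronglyMeasurable ?_
    refine (ae_restrict_iff' measurableSet_Ioc).2 (ae_of_all _ fun t ht => ?_)
    have h0 : 0 < t ^ a := Real.rpow_pos_of_pos ht.1 a
    rw [Real.norm_of_nonneg (by positivity), div_le_one (by positivity)]
    linarith
  · refine Integrable.mono' (integrableOn_Ioi_rpow_of_lt (a := -a) (by linarith) one_pos)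
      hm.aestronglyMeasurable ?_
    refine (ae_restrict_iff' measurableSet_Ioi).2 (ae_of_all _ fun t ht => ?_)
    have h0 : 0 < t ^ a := Real.rpow_pos_of_pos (one_pos.trans ht) a
    rw [Real.norm_of_nonneg (by positivity), Real.rpow_neg (one_pos.trans ht).le, one_div]
    exact inv_anti₀ h0 (by linarith)

section

variable {N : ℕ} {p : Params N}

lemma integrableOn_fade_div (hp : p.Admissible) {A : ℝ} (hA : 0 < A) :
    IntegrableOn (fun t : ℝ => 1 / (1 + (t / A) ^ (p.alpha / 2))) (Set.Ioi 0) := by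
  have hα : 1 < p.alpha / 2 := by linarith [hp.two_lt_alpha]
  have := (integrableOn_Ioi_comp_mul_left_iff (fun t : ℝ => 1 / (1 + t ^ (p.alpha / 2))) 0
    (inv_pos.2 hA)).2 (by simpa using integrableOn_fade hα)
  simpa only [inv_mul_eq_div] using this

lemma integral_fade_div (p : Params N) {A : ℝ} (hA : 0 < A) (c : ℝ) :
    ∫ t in Set.Ioi c, 1 / (1 + (t / A) ^ (p.alpha / 2)) =
      A * ∫ t in Set.Ioi (c / A), 1 / (1 + t ^ (p.alpha / 2)) := by
  have := integral_comp_mul_left_Ioi (fun t : ℝ => 1 / (1 + t ^ (p.alpha / 2))) c (inv_pos.2 hA)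
  simpa only [inv_mul_eq_div, inv_inv, smul_eq_mul] using this

lemma xi1_sub_xi2 (hp : p.Admissible) {x : ℝ} (hx : 0 ≤ x) :
    p.xi1 - p.xi2 x = ∫ t in Set.Ioi (x ^ (-2 / p.alpha)), 1 / (1 + t ^ (p.alpha / 2)) := by
  have hα : 1 < p.alpha / 2 := by linarith [hp.two_lt_alpha]
  rw [Params.xi1, Params.xi2, ← intervalIntegral.integral_Ioi_sub_Ioi (integrableOn_fade hα)
    (Real.rpow_nonneg hx _)]
  ring

/-- The radial profile of the defect, as a function of the squared distance. -/
lemma pointDefect_eq (hp : p.Admissible) (i : Fin N) {r : ℝ} (hr : 0 < r) {y : Plane} (hy : y ≠ 0) :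
    pointDefect p i r y = (∑ j, p.txProb j - p.txProb i) *
      (1 / (1 + (‖y‖ ^ 2 / (r ^ 2 * p.Gamma1 ^ (2 / p.alpha))) ^ (p.alpha / 2))) +
      ((Set.Iio (r ^ 2)).indicator (fun _ => p.pc i) (‖y‖ ^ 2) +
        (Set.Ici (r ^ 2)).indicator (fun t => p.txProb i *
          (1 / (1 + (t / (r ^ 2 * p.Gamma1 ^ (2 / p.alpha))) ^ (p.alpha / 2)))) (‖y‖ ^ 2)) := by
  have hG := hp.Gamma1_pos
  have hα := hp.two_lt_alpha
  have hy' : 0 < ‖y‖ := norm_pos_iff.2 hy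
  have h1 : (‖y‖ ^ 2 / (r ^ 2 * p.Gamma1 ^ (2 / p.alpha))) ^ (p.alpha / 2) =
      (p.Gamma1 * (r / ‖y‖) ^ p.alpha)⁻¹ := by
    rw [Real.div_rpow (by positivity) (by positivity),
      Real.mul_rpow (by positivity) (by positivity), ← Real.rpow_mul hG.le,
      ← Real.rpow_natCast, ← Real.rpow_natCast, ← Real.rpow_mul hy'.le,
      ← Real.rpow_mul hr.le, Real.div_rpow hr.le hy'.le]
    have e1 : ((2 : ℕ) : ℝ) * (p.alpha / 2) = p.alpha := by push_cast; ring
    have e2 : 2 / p.alpha * (p.alpha / 2) = 1 := by field_simp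
    rw [e1, e2, Real.rpow_one]
    have := (Real.rpow_pos_of_pos hr p.alpha).ne'
    have := (Real.rpow_pos_of_pos hy' p.alpha).ne'
    field_simp
  have hs : 0 < p.Gamma1 * (r / ‖y‖) ^ p.alpha := by positivity
  have h2 : 1 / (1 + (p.Gamma1 * (r / ‖y‖) ^ p.alpha)⁻¹) =
      p.Gamma1 * (r / ‖y‖) ^ p.alpha / (1 + p.Gamma1 * (r / ‖y‖) ^ p.alpha) := by
    field_simp
    ring
  have h3 : ‖y‖ < r ↔ ‖y‖ ^ 2 < r ^ 2 := (pow_lt_pow_iff_left₀ hy'.le hr.le two_ne_zero).symm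
  rw [pointDefect, defect, h1, h2]
  congr 1
  by_cases h : ‖y‖ < r
  · rw [if_pos h, Set.indicator_of_mem (Set.mem_Iio.2 (h3.1 h)),
      Set.indicator_of_notMem (by simpa using h3.1 h),
      add_zero]
  · have h4 : r ^ 2 ≤ ‖y‖ ^ 2 := not_lt.1 (fun h' => h (h3.2 h'))
    rw [if_neg h, Set.indicator_of_notMem (by simpa using h4),
      Set.indicator_of_mem (Set.mem_Ici.2 h4), h1, h2, zero_add]

/-- The exponent of the Mecke formula, in closed form. -/
lemma integral_pointDefect (hp : p.Admissible) (i : Fin N) {r : ℝ} (hr : 0 < r) :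
    Integrable (pointDefect p i r) ∧ p.lam * ∫ y, pointDefect p i r y =
      p.helperDensity i * Real.pi * r ^ 2 +
      Real.pi * (p.totalTxDensity * p.xi1 - p.txDensity i * p.xi2 p.Gamma1) * r ^ 2 *
        p.Gamma1 ^ (2 / p.alpha) := by
  have hG := hp.Gamma1_pos
  have hα := hp.two_lt_alpha
  have hA : 0 < r ^ 2 * p.Gamma1 ^ (2 / p.alpha) := by positivity
  set A := r ^ 2 * p.Gamma1 ^ (2 / p.alpha) with hAdef
  set V : ℝ → ℝ := fun t => 1 / (1 + (t / A) ^ (p.alpha / 2)) with hV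
  let H : ℝ → ℝ := fun t => (∑ j, p.txProb j - p.txProb i) * V t +
      ((Set.Iio (r ^ 2)).indicator (fun _ => p.pc i) t +
        (Set.Ici (r ^ 2)).indicator (fun t => p.txProb i * V t) t)
  have hVi : IntegrableOn V (Set.Ioi 0) := integrableOn_fade_div hp hA
  have hset1 : Set.Ioi (0 : ℝ) ∩ Set.Iio (r ^ 2) = Set.Ioo 0 (r ^ 2) := rfl
  have hset2 : Set.Ioi (0 : ℝ) ∩ Set.Ici (r ^ 2) = Set.Ici (r ^ 2) :=
    Set.inter_eq_right.2 fun _ ht => Set.mem_Ioi.2 ((pow_pos hr 2).trans_le ht)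
  have hI1 : IntegrableOn (fun t => (∑ j, p.txProb j - p.txProb i) * V t) (Set.Ioi 0) :=
    hVi.const_mul _
  have hI2 : IntegrableOn ((Set.Iio (r ^ 2)).indicator fun _ => p.pc i) (Set.Ioi 0) := by
    rw [IntegrableOn, integrable_indicator_iff measurableSet_Iio, IntegrableOn,
      Measure.restrict_restrict measurableSet_Iio, Set.inter_comm, hset1]
    exact integrableOn_const (by simp)
  have hI3 : IntegrableOn ((Set.Ici (r ^ 2)).indicator fun t => p.txProb i * V t) (Set.Ioi 0) :=
    (hVi.const_mul _).indicator measurableSet_Ici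
  have hH : IntegrableOn H (Set.Ioi 0) := hI1.add (hI2.add hI3)
  have hae : ∀ᵐ y : Plane, y ≠ 0 := by
    rw [ae_iff]
    simp
  have hintH : ∫ t in Set.Ioi (0 : ℝ), H t = (∑ j, p.txProb j - p.txProb i) * (A * p.xi1) +
      (r ^ 2 * p.pc i + p.txProb i * (A * (p.xi1 - p.xi2 p.Gamma1))) := by
    rw [show ∫ t in Set.Ioi (0 : ℝ), H t = _ from (integral_add hI1 (hI2.add hI3)).trans
      (congrArg _ (integral_add hI2 hI3)), integral_const_mul,
      setIntegral_indicator measurableSet_Iio, hset1,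
      setIntegral_indicator measurableSet_Ici, hset2, setIntegral_const, integral_const_mul,
      integral_Ici_eq_integral_Ioi, hV, integral_fade_div p hA,
      integral_fade_div p hA, xi1_sub_xi2 hp hG.le]
    have e1 : r ^ 2 / A = p.Gamma1 ^ (-2 / p.alpha) := by
      rw [hAdef, neg_div, Real.rpow_neg hG.le]
      field_simp
    rw [e1, zero_div, Params.xi1]
    simp [sq_nonneg r]
  refine ⟨(integrable_norm_sq hH).congr (hae.mono fun y hy => (pointDefect_eq hp i hr hy).symm), ?_⟩
  rw [integral_congr_ae (hae.mono fun y hy => pointDefect_eq hp i hr hy), integral_norm_sq H,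
    hintH, Params.totalTxDensity, Params.helperDensity]
  simp_rw [← hp.lam_mul_txProb]
  rw [← mul_sum, hAdef]
  ring

lemma Network.Model.expNeg_lintegral_pointDefect {Ω : Type*} [MeasurableSpace Ω] {P : Measure Ω}
    [IsProbabilityMeasure P] {net : Network N Ω} (hp : p.Admissible) (hnet : net.Model P p)
    (i : Fin N) {r : ℝ} (hr : 0 < r) :
    expNeg (∫⁻ y, ENNReal.ofReal (pointDefect p i r y)
      ∂(ENNReal.ofReal p.lam • (volume : Measure Plane))) =
    ENNReal.ofReal (Real.exp (-(p.helperDensity i * Real.pi * r ^ 2 +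
      Real.pi * (p.totalTxDensity * p.xi1 - p.txDensity i * p.xi2 p.Gamma1) * r ^ 2 *
        p.Gamma1 ^ (2 / p.alpha)))) := by
  obtain ⟨h1, h2⟩ := integral_pointDefect hp i hr
  have h0 (y : Plane) : 0 ≤ pointDefect p i r y :=
    hnet.defect_nonneg hp i _ (fade_nonneg hp hr.le (norm_nonneg y))
  rw [lintegral_smul_measure, ← ofReal_integral_eq_lintegral_ofReal h1 (ae_of_all _ h0),
    smul_eq_mul, ← ENNReal.ofReal_mul hp.lam_pos.le,
    expNeg_ofReal (mul_nonneg hp.lam_pos.le (integral_nonneg h0)), h2]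

end

namespace Network.Model

variable {N : ℕ} {Ω : Type*} [MeasurableSpace Ω] {P : Measure Ω}
    [IsProbabilityMeasure P] {p : Params N} {net : Network N Ω}
    (hp : p.Admissible) (hnet : net.Model P p)
include hp hnet

/-- The probability `measure_exists_servedSet` in polar coordinates. -/
lemma measure_exists_servedSet_eq (i : Fin N) :
    P {ω | ∃ n, ((fun m => net.pos m ω), (fun m => net.mark m ω)) ∈ servedSet p i n} =
      ENNReal.ofReal (∫ r in (0 : ℝ)..p.rc, p.linkPdf i r * Real.exp (-p.phi i p.Gamma1 r)) := by
  have hG := hp.Gamma1_pos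
  have hs := hp.sigmaSq_pos
  have hPt := hp.Pt_pos
  set c := Real.pi * (p.totalTxDensity * p.xi1 - p.txDensity i * p.xi2 p.Gamma1) with hc
  let g : ℝ → ℝ := (Set.Iio p.rc).indicator fun r =>
    p.pc i * Real.exp (-(p.Gamma1 * r ^ p.alpha * (p.sigmaSq / p.Pt))) *
      Real.exp (-(p.helperDensity i * Real.pi * r ^ 2 + c * r ^ 2 * p.Gamma1 ^ (2 / p.alpha)))
  have hgm : Measurable g := Measurable.indicator (by fun_prop) measurableSet_Iio
  have hae : ∀ᵐ x ∂(volume : Measure Plane), x ≠ 0 := by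
    rw [ae_iff]
    simp
  have hpt (x : Plane) (hx : x ≠ 0) :
      (Metric.ball (0 : Plane) p.rc).indicator (fun x => ENNReal.ofReal (p.pc i) *
        expNeg (ENNReal.ofReal (p.Gamma1 * ‖x‖ ^ p.alpha * (p.sigmaSq / p.Pt)))) x *
          expNeg (∫⁻ y, ENNReal.ofReal (pointDefect p i ‖x‖ y)
            ∂(ENNReal.ofReal p.lam • (volume : Measure Plane))) = ENNReal.ofReal (g ‖x‖) := by
    by_cases h : ‖x‖ < p.rc
    · rw [Set.indicator_of_mem (by simpa using h), hnet.expNeg_lintegral_pointDefect hp i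
        (norm_pos_iff.2 hx), expNeg_ofReal (by positivity), ← ENNReal.ofReal_mul (hp.pc_nonneg i),
        ← ENNReal.ofReal_mul (mul_nonneg (hp.pc_nonneg i) (Real.exp_pos _).le)]
      simp only [g]
      rw [Set.indicator_of_mem (Set.mem_Iio.2 h)]
    · simp only [g]
      rw [Set.indicator_of_notMem (by simpa using h), Set.indicator_of_notMem (by simpa using h),
        zero_mul, ENNReal.ofReal_zero]
  have hg0 (x : Plane) : 0 ≤ g ‖x‖ :=
    Set.indicator_nonneg (fun r _ => mul_nonneg (mul_nonneg (hp.pc_nonneg i) (Real.exp_pos _).le)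
      (Real.exp_pos _).le) _
  have hfin : ∫⁻ x : Plane, ENNReal.ofReal (g ‖x‖) ≠ ∞ := by
    -- the left-hand side of `measure_exists_servedSet` is a probability
    have h1 := hnet.measure_exists_servedSet hp i
    rw [lintegral_smul_measure, lintegral_congr_ae (hae.mono hpt), smul_eq_mul] at h1
    intro h2
    rw [h2, ENNReal.mul_top (ENNReal.ofReal_pos.2 hp.lam_pos).ne'] at h1
    exact measure_ne_top _ _ h1
  have hint : Integrable fun x : Plane => g ‖x‖ :=
    (lintegral_ofReal_ne_top_iff_integrable (hgm.comp measurable_norm).aestronglyMeasurable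
      (ae_of_all _ hg0)).1 hfin
  have hb : volume.real (Metric.ball (0 : Plane) 1) = Real.pi := by
    rw [measureReal_def, volume_ball_plane 1 zero_le_one, ENNReal.toReal_ofReal (by positivity)]
    ring
  rw [hnet.measure_exists_servedSet hp i, lintegral_smul_measure, lintegral_congr_ae (hae.mono hpt),
    smul_eq_mul, ← ofReal_integral_eq_lintegral_ofReal hint (ae_of_all _ hg0),
    ← ENNReal.ofReal_mul hp.lam_pos.le, integral_fun_norm_addHaar volume g, hb]
  congr 1
  have hset : Set.Ioi (0 : ℝ) ∩ Set.Iio p.rc = Set.Ioo 0 p.rc := rfl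
  have hi : ∫ y in Set.Ioi (0 : ℝ), y ^ (Module.finrank ℝ Plane - 1) • g y =
      ∫ y in (0 : ℝ)..p.rc, y * (p.pc i *
        Real.exp (-(p.Gamma1 * y ^ p.alpha * (p.sigmaSq / p.Pt))) *
      Real.exp (-(p.helperDensity i * Real.pi * y ^ 2 +
        c * y ^ 2 * p.Gamma1 ^ (2 / p.alpha)))) := by
    rw [intervalIntegral.integral_of_le hp.rc_pos.le, integral_Ioc_eq_integral_Ioo, ← hset,
      ← setIntegral_indicator measurableSet_Iio]
    congr 1
    ext y
    simp only [finrank_euclideanSpace, Fintype.card_fin, g, smul_eq_mul]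
    by_cases hy : y ∈ Set.Iio p.rc
    · simp only [Set.indicator_of_mem hy]
      norm_num
    · simp only [Set.indicator_of_notMem hy, mul_zero]
  rw [hi, nsmul_eq_mul, smul_eq_mul, ← mul_assoc, ← mul_assoc, mul_assoc, mul_assoc,
    ← intervalIntegral.integral_const_mul, ← intervalIntegral.integral_const_mul]
  rw [← intervalIntegral.integral_const_mul]
  refine intervalIntegral.integral_congr fun r _ => ?_
  simp only [Params.linkPdf, Params.phi, finrank_euclideanSpace, Fintype.card_fin]
  rw [mul_assoc (2 * Real.pi * r * p.helperDensity i), ← Real.exp_add, mul_assoc (p.pc i),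
    ← Real.exp_add, ← hc, Params.helperDensity]
  push_cast
  ring_nf

/-- The offloading probability in closed form. -/
lemma offloadingProbability_eq : net.offloadingProbability P p =
      ∑ i, p.popularity i *
        ∫ r in (0 : ℝ)..p.rc, p.linkPdf i r * Real.exp (-p.phi i p.Gamma1 r) := by
  rw [offloadingProbability, measureReal_def, hnet.measure_offloading hp,
    ENNReal.toReal_sum fun i _ => ENNReal.mul_ne_top ENNReal.ofReal_ne_top (measure_ne_top _ _)]
  refine sum_congr rfl fun i _ => ?_
  rw [hnet.measure_exists_servedSet_eq hp, ENNReal.toReal_mul,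
    ENNReal.toReal_ofReal (p.popularity_nonneg i), ENNReal.toReal_ofReal]
  refine intervalIntegral.integral_nonneg hp.rc_pos.le fun r hr => ?_
  refine mul_nonneg (mul_nonneg ?_ (Real.exp_pos _).le) (Real.exp_pos _).le
  have h1 := hr.1
  have h2 := mul_nonneg hp.lam_pos.le (hp.pc_nonneg i)
  rw [Params.helperDensity]
  positivity

/-! ### Densities of helpers and transmitters -/

/-- The void probability of the users that cache file `i`. -/
lemma measure_no_helper (i : Fin N) {r : ℝ} (hr : 0 ≤ r) :
    P {ω | ∀ m, ¬ (net.cached m ω = i ∧ ‖net.pos m ω‖ < r)} =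
      ENNReal.ofReal (Real.exp (-(p.helperDensity i * Real.pi * r ^ 2))) := by
  classical
  have hX : Measurable fun ω m => net.pos m ω := measurable_pi_iff.2 hnet.users.measurable
  have hM : Measurable fun ω m => net.cached m ω := measurable_pi_iff.2 hnet.measurable_cached
  have hball : MeasurableSet (Metric.ball (0 : Plane) r) := measurableSet_ball
  have hind : IndepFun (fun ω m => net.pos m ω) (fun ω m => net.cached m ω) P :=
    hnet.pos_marks_indep.comp (φ := id) (ψ := fun (y : ℕ → (Fin N × ℝ × ℕ) × ℝ) m => (y m).1.1)
      measurable_id (by fun_prop)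
  have hc : iIndepFun net.cached P :=
    hnet.marks_indep.comp (fun _ z => z.1.1) (fun _ => by fun_prop)
  have hf1 (m : ℕ) (q : Prop) [Decidable q] :
      Measurable fun j : Fin N => if ¬ (j = i ∧ q) then (1 : ℝ≥0∞) else 0 := measurable_of_finite _
  let f : (ℕ → Plane) × (ℕ → Fin N) → ℝ≥0∞ := fun z =>
    iprod fun m => if ¬ (z.2 m = i ∧ z.1 m ∈ Metric.ball (0 : Plane) r) then 1 else 0
  have hf : Measurable f := by
    refine measurable_iprod fun m => Measurable.ite ?_ measurable_const measurable_const
    have m1 : Measurable fun z : (ℕ → Plane) × (ℕ → Fin N) => z.2 m := by fun_prop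
    have m2 : Measurable fun z : (ℕ → Plane) × (ℕ → Fin N) => z.1 m := by fun_prop
    exact ((m1 (measurableSet_singleton i)).inter (m2 hball)).compl
  have h1 := lintegral_of_indepFun hX hM hind hf
  have hset : MeasurableSet {ω | ∀ m, ¬ (net.cached m ω = i ∧ ‖net.pos m ω‖ < r)} := by
    rw [show {ω | ∀ m, ¬ (net.cached m ω = i ∧ ‖net.pos m ω‖ < r)} =
      ⋂ m, ({ω | net.cached m ω = i} ∩ {ω | ‖net.pos m ω‖ < r})ᶜ by ext; simp]
    exact .iInter fun m => ((hnet.measurableSet_cached m i).inter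
      (measurableSet_lt (hnet.users.measurable m).norm measurable_const)).compl
  have h2 : ∫⁻ ω, f ((fun m => net.pos m ω), (fun m => net.cached m ω)) ∂P =
      P {ω | ∀ m, ¬ (net.cached m ω = i ∧ ‖net.pos m ω‖ < r)} := by
    rw [← lintegral_indicator_one hset]
    refine lintegral_congr fun ω => ?_
    simp only [f]
    rw [iprod_indicator, Set.indicator_apply]
    simp
  have h3 (ω : Ω) : ∫⁻ ω', f ((fun m => net.pos m ω), (fun m => net.cached m ω')) ∂P =
      iprod fun m => if m ∈ {m | net.pos m ω ∈ Metric.ball (0 : Plane) r} then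
        1 - ENNReal.ofReal (p.pc i) else 1 := by
    refine (lintegral_iprod_of_iIndepFun (a := fun m ω' =>
      if ¬ (net.cached m ω' = i ∧ net.pos m ω ∈ Metric.ball (0 : Plane) r) then 1 else 0)
      (fun m => (hf1 m _).comp (hnet.measurable_cached m)) (fun m ω' => by split_ifs <;> simp)
      (hc.comp _ fun m => hf1 m _)).trans ?_
    congr 1
    ext m
    by_cases hm : net.pos m ω ∈ Metric.ball (0 : Plane) r
    · rw [if_pos (show m ∈ {m | net.pos m ω ∈ Metric.ball (0 : Plane) r} from hm),
        ← hnet.measure_cached hp m i, ← prob_compl_eq_one_sub (hnet.measurableSet_cached m i),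
        ← lintegral_indicator_one (hnet.measurableSet_cached m i).compl]
      refine lintegral_congr fun ω' => ?_
      rw [Set.indicator_apply]
      simp [hm]
    · rw [if_neg (show ¬ m ∈ {m | net.pos m ω ∈ Metric.ball (0 : Plane) r} from hm)]
      simp [hm]
  have hpc : ENNReal.ofReal (p.pc i) ≤ 1 := by
    rw [← hnet.measure_cached hp 0 i]
    exact prob_le_one
  have hfin : (ENNReal.ofReal p.lam • (volume : Measure Plane)) (Metric.ball 0 r) ≠ ∞ := by
    rw [Measure.smul_apply, smul_eq_mul]
    exact ENNReal.mul_ne_top ENNReal.ofReal_ne_top measure_ball_lt_top.ne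
  have h4 : ∫⁻ ω, iprod (fun m => if m ∈ {m | net.pos m ω ∈ Metric.ball (0 : Plane) r} then
        1 - ENNReal.ofReal (p.pc i) else 1) ∂P =
      ∫⁻ ω, (1 - ENNReal.ofReal (p.pc i)) ^
        (count net.pos (Metric.ball (0 : Plane) r) ω).toNat ∂P := by
    refine lintegral_congr_ae ((hnet.users.ae_count_ne_top hball hfin).mono fun ω hω => ?_)
    exact iprod_ite_const (Set.encard_ne_top_iff.1 hω) tsub_le_self
  rw [← h2, h1]
  simp_rw [h3]
  rw [h4, hnet.users.lintegral_comp_count hball hfin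
    (fun k => (1 - ENNReal.ofReal (p.pc i)) ^ k.toNat)]
  simp only [ENat.toNat_natCast]
  have hl := hp.lam_pos
  rw [lintegral_pow_poissonMeasure _ hpc, ENNReal.coe_toNNReal hfin, Measure.smul_apply,
    volume_ball_plane r hr, smul_eq_mul, ← ENNReal.ofReal_mul hl.le,
    ← ENNReal.ofReal_mul (hp.pc_nonneg i), expNeg_ofReal
      (mul_nonneg (hp.pc_nonneg i) (by positivity)), Params.helperDensity]
  congr 3
  ring

lemma measureReal_exists_helper (i : Fin N) {r : ℝ} (hr : 0 ≤ r) :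
    P.real {ω | ∃ m, net.cached m ω = i ∧ ‖net.pos m ω‖ < r} =
      1 - Real.exp (-(p.helperDensity i * Real.pi * r ^ 2)) := by
  have h1 : {ω | ∃ m, net.cached m ω = i ∧ ‖net.pos m ω‖ < r} =
      {ω | ∀ m, ¬ (net.cached m ω = i ∧ ‖net.pos m ω‖ < r)}ᶜ := by
    ext; simp
  have hset : MeasurableSet {ω | ∀ m, ¬ (net.cached m ω = i ∧ ‖net.pos m ω‖ < r)} := by
    rw [show {ω | ∀ m, ¬ (net.cached m ω = i ∧ ‖net.pos m ω‖ < r)} =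
      ⋂ m, ({ω | net.cached m ω = i} ∩ {ω | ‖net.pos m ω‖ < r})ᶜ by ext; simp]
    exact .iInter fun m => ((hnet.measurableSet_cached m i).inter
      (measurableSet_lt (hnet.users.measurable m).norm measurable_const)).compl
  rw [h1, probReal_compl_eq_one_sub hset, measureReal_def, hnet.measure_no_helper hp i hr,
    ENNReal.toReal_ofReal (Real.exp_pos _).le]

/-- The closed event `helperDist ≤ r` is squeezed between the open events of radius `r` and of
radii `s ↓ r`, whose probabilities are continuous in the radius. -/
lemma measureReal_helperDist_le (i : Fin N) {r : ℝ} (hr : 0 ≤ r) :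
    P.real {ω | net.helperDist i ω ≤ ENNReal.ofReal r} =
      1 - Real.exp (-(p.helperDensity i * Real.pi * r ^ 2)) := by
  refine le_antisymm ?_ ?_
  · have hlim : Tendsto (fun s => 1 - Real.exp (-(p.helperDensity i * Real.pi * s ^ 2)))
        (𝓝[>] r) (𝓝 (1 - Real.exp (-(p.helperDensity i * Real.pi * r ^ 2)))) := by
      have : Continuous fun s => 1 - Real.exp (-(p.helperDensity i * Real.pi * s ^ 2)) := by
        fun_prop
      exact (this.tendsto r).mono_left nhdsWithin_le_nhds
    refine ge_of_tendsto hlim ?_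
    filter_upwards [self_mem_nhdsWithin] with s hs
    have hs' : r < s := hs
    rw [← hnet.measureReal_exists_helper hp i (hr.trans hs'.le)]
    refine measureReal_mono fun ω hω => ?_
    have h1 : net.helperDist i ω < ENNReal.ofReal s :=
      lt_of_le_of_lt hω ((ENNReal.ofReal_lt_ofReal_iff (hr.trans_lt hs')).2 hs')
    simp only [helperDist, iInf_lt_iff] at h1
    obtain ⟨m, hm, h2⟩ := h1
    refine ⟨m, hm, ?_⟩
    rw [← ofReal_norm] at h2
    exact (ENNReal.ofReal_lt_ofReal_iff (hr.trans_lt hs')).1 h2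
  · rw [← hnet.measureReal_exists_helper hp i hr]
    refine measureReal_mono fun ω hω => ?_
    obtain ⟨m, hm, h2⟩ := hω
    refine (iInf₂_le (f := fun k (_ : net.cached k ω = i) => ‖net.pos k ω‖ₑ) m hm).trans ?_
    rw [← ofReal_norm]
    exact ENNReal.ofReal_le_ofReal h2.le

omit hp in
/-- Campbell's formula for the users whose mark lies in a set of marks. -/
lemma lintegral_encard {D : Set ((Fin N × ℝ × ℕ) × ℝ)} (hD : MeasurableSet D) {q : ℝ≥0∞}
    (hq : ∀ n, P {ω | net.mark n ω ∈ D} = q) {B : Set Plane} (hB : MeasurableSet B) :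
    ∫⁻ ω, ({n | net.pos n ω ∈ B ∧ net.mark n ω ∈ D}.encard : ℝ≥0∞) ∂P =
      q * (ENNReal.ofReal p.lam * volume B) := by
  have hc := hnet.users.tsum_lintegral (measurable_one.indicator hB)
  rw [lintegral_indicator_one hB, Measure.smul_apply, smul_eq_mul] at hc
  have h1 (ω : Ω) : ({n | net.pos n ω ∈ B ∧ net.mark n ω ∈ D}.encard : ℝ≥0∞) =
      ∑' n, (net.pos n ⁻¹' B ∩ net.mark n ⁻¹' D).indicator 1 ω := by
    rw [← ENNReal.tsum_set_one]
    exact _root_.tsum_subtype _ (fun _ => (1 : ℝ≥0∞))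
  have hm (n : ℕ) : MeasurableSet (net.pos n ⁻¹' B ∩ net.mark n ⁻¹' D) :=
    (hnet.users.measurable n hB).inter (hnet.measurable_mark n hD)
  simp_rw [h1]
  rw [lintegral_tsum fun n => (measurable_one.indicator (hm n)).aemeasurable, ← hc,
    ← ENNReal.tsum_mul_left]
  refine tsum_congr fun n => ?_
  have hind : IndepFun (net.pos n) (net.mark n) P :=
    hnet.pos_marks_indep.comp (measurable_pi_apply n) (measurable_pi_apply n)
  have h2 : ∫⁻ ω, B.indicator 1 (net.pos n ω) ∂P = P (net.pos n ⁻¹' B) :=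
    lintegral_indicator_one (hnet.users.measurable n hB)
  rw [lintegral_indicator_one (hm n), hind.measure_inter_preimage_eq_mul _ _ hB hD, h2, ← hq n,
    mul_comm]
  rfl

end Network.Model

lemma integral_linkPdf {N : ℕ} (p : Params N) (i : Fin N) (r : ℝ) :
    ∫ s in (0 : ℝ)..r, p.linkPdf i s =
      1 - Real.exp (-(p.helperDensity i * Real.pi * r ^ 2)) := by
  have h (s : ℝ) : HasDerivAt (fun s => -Real.exp (-(p.helperDensity i * Real.pi * s ^ 2)))
      (p.linkPdf i s) s := by
    have h1 := (((hasDerivAt_pow 2 s).const_mul (p.helperDensity i * Real.pi)).neg).exp.neg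
    refine h1.congr_deriv ?_
    simp only [Params.linkPdf, Pi.neg_apply]
    push_cast
    ring
  rw [intervalIntegral.integral_eq_sub_of_hasDerivAt (fun s _ => h s)]
  · simp
    ring
  · refine Continuous.intervalIntegrable ?_ _ _
    unfold Params.linkPdf
    fun_prop

end D2D

open MeasureTheory in
theorem proposition2 {N : ℕ} {Ω : Type*} [MeasurableSpace Ω] (P : Measure Ω)
    [IsProbabilityMeasure P] (p : D2D.Params N) (hp : p.Admissible)
    (net : D2D.Network N Ω) (hnet : net.Model P p) :
    -- the offloading probability
    net.offloadingProbability P p =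
      ∑ i, p.popularity i *
        ∫ r in (0 : ℝ)..p.rc, p.linkPdf i r * Real.exp (-p.phi i p.Gamma1 r) ∧
    -- `linkPdf i` is the density of the distance to the nearest helper with file `i`
    (∀ (i : Fin N) (r : ℝ), 0 ≤ r →
      P.real {ω | net.helperDist i ω ≤ ENNReal.ofReal r} = ∫ s in (0 : ℝ)..r, p.linkPdf i s) ∧
    -- `txDensity i` is the density of the transmitters that cache file `i`
    (∀ (i : Fin N) (B : Set D2D.Plane), MeasurableSet B →
      ∫⁻ ω, ({n | net.pos n ω ∈ B ∧ net.cached n ω = i ∧ net.IsTransmitter n ω}.encard : ENNReal) ∂P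
        = ENNReal.ofReal (p.txDensity i) * volume B) ∧
    -- `totalTxDensity` is the density of all transmitters
    (∀ B : Set D2D.Plane, MeasurableSet B →
      ∫⁻ ω, ({n | net.pos n ω ∈ B ∧ net.IsTransmitter n ω}.encard : ENNReal) ∂P
        = ENNReal.ofReal p.totalTxDensity * volume B) := by
  have m1 : Measurable fun z : (Fin N × ℝ × ℕ) × ℝ => z.1.1 := by fun_prop
  have m2 : Measurable fun z : (Fin N × ℝ × ℕ) × ℝ => z.1.2.2 := by fun_prop
  refine ⟨hnet.offloadingProbability_eq hp, fun i r hr => ?_, fun i B hB => ?_, fun B hB => ?_⟩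
  · rw [hnet.measureReal_helperDist_le hp i hr, D2D.integral_linkPdf]
  · have h := hnet.lintegral_encard
      (D := {z | z.1.1 = i ∧ z.1.2.2 ≠ 0}) (q := ENNReal.ofReal (p.txProb i))
      ((m1 (measurableSet_singleton i)).inter (m2 (measurableSet_singleton 0)).compl)
      (fun n => by
        rw [← hnet.measureReal_cached_isTransmitter hp n i, ofReal_measureReal]
        rfl) hB
    rw [← mul_assoc, ← ENNReal.ofReal_mul (hnet.txProb_nonneg hp i), mul_comm (p.txProb i),
      hp.lam_mul_txProb] at h
    exact h
  · have h := hnet.lintegral_encard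
      (D := {z | z.1.2.2 ≠ 0}) (q := ENNReal.ofReal (∑ j, p.txProb j))
      (m2 (measurableSet_singleton 0)).compl
      (fun n => by
        rw [← hnet.measureReal_isTransmitter hp n, ofReal_measureReal]
        rfl) hB
    rw [← mul_assoc, ← ENNReal.ofReal_mul (Finset.sum_nonneg fun j _ => hnet.txProb_nonneg hp j),
      mul_comm (∑ j, p.txProb j), Finset.mul_sum] at h
    simp_rw [hp.lam_mul_txProb] at h
    exact h
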